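/- Let $R$ be a commutative ring with identity, let $n \ge 1$ be an integer, and let $C$ be a semidualizing $R$-module; that is, $C$ has a projective resolution by finitely generated projective $R$-modules, the homothety map $R \to \operatorname{Hom}_R(C,C)$, $r \mapsto (c \mapsto rc)$, is an isomorphism, and $\operatorname{Ext}_R^i(C,C)=0$ for all $i\ge 1$. An $R$-module $M$ is called finitely $n$-presented if there is an exact sequence $F_n\to F_{n-1}\to\cdots\to F_1\to F_0\to M\to 0$ with every $F_i$ finitely generated and free. An $R$-module $X$ is called $fp_n$-injective (resp. $fp_n$-flat) if for every monomorphism $K\to L$ of finitely $n$-presented $R$-modules the induced map $\operatorname{Hom}_R(L,X)\to\operatorname{Hom}_R(K,X)$ is surjective (resp. $K\otimes_R X\to L\otimes_R X$ is injective). Let $Cfp_nI(R)$ be the class of $R$-modules isomorphic to $\operatorname{Hom}_R(C,X)$ for some $fp_n$-injective $R$-module $X$, and let $Cfp_nF(R)$ be the class of $R$-modules isomorphic to $C\otimes_R Y$ for some $fp_n$-flat $R$-module $Y$. For a class $\mathcal F$ of $R$-modules, an $\mathcal F$-preenvelope of $M$ is a homomorphism $f:M\to F$ with $F\in\mathcal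 F$ such that every homomorphism $M\to F'$ with $F'\in\mathcal F$ factors through $f$. An $\mathcal F$-precover of $M$ is a homomorphism $f:F\to M$ with $F\in\mathcal F$ such that every homomorphism $F'\to M$ with $F'\in\mathcal F$ factors through $f$; it is an $\mathcal F$-cover if moreover every endomorphism $g$ of $F$ with $fg=f$ is an isomorphism. Then the following assertions are equivalent: (i) $R\in Cfp_nI(R)$; (ii) every $R$-module has a monic $Cfp_nF(R)$-preenvelope; (iii) $\operatorname{Hom}_R(E,E')\in Cfp_nI(R)$ for all injective $R$-modules $E$ and $E'$; (iv) $F\otimes_R F'\in Cfp_nI(R)$ for all flat $R$-modules $F$ and $F'$; (v) every $R$-module has an epic $Cfp_nI(R)$-cover; (vi) $\operatorname{Hom}_R(P,P')\in Cfp_nI(R)$ for all projective $R$-modules $P$ and $P'$. -/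

import Mathlib

universe u

/-- `M` is finitely `n`-presented: there is an exact sequence
`F_n ⟶ F_{n-1} ⟶ ⋯ ⟶ F_1 ⟶ F_0 ⟶ M ⟶ 0` with each `F_i = R ^ (k i)` finitely generated free.
Only `k 0, …, k n` and `d 0, …, d (n-1)` matter; the later data are unconstrained. -/
def IsFinitelyNPresented (R : Type u) [CommRing R] (n : ℕ)
    (M : Type u) [AddCommGroup M] [Module R M] : Prop :=
  ∃ (k : ℕ → ℕ) (d : ∀ i, (Fin (k (i + 1)) → R) →ₗ[R] (Fin (k i) → R))
    (ε : (Fin (k 0) → R) →ₗ[R] M),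
    Function.Surjective ε ∧
    (0 < n → Function.Exact (d 0) ε) ∧
    ∀ i, i + 1 < n → Function.Exact (d (i + 1)) (d i)

/-- `M` is `fp_n`-injective: `Hom(L, M) ⟶ Hom(K, M)` is surjective for every monomorphism `K ⟶ L`
of finitely `n`-presented modules. -/
def IsFpInjective (R : Type u) [CommRing R] (n : ℕ)
    (M : Type u) [AddCommGroup M] [Module R M] : Prop :=
  ∀ (K L : Type u) [AddCommGroup K] [Module R K] [AddCommGroup L] [Module R L],
    IsFinitelyNPresented R n K → IsFinitelyNPresented R n L →
    ∀ f : K →ₗ[R] L, Function.Injective f →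
      Function.Surjective (fun h : L →ₗ[R] M => h ∘ₗ f)

/-- `M` is `fp_n`-flat: `K ⊗ M ⟶ L ⊗ M` is injective for every monomorphism `K ⟶ L`
of finitely `n`-presented modules. -/
def IsFpFlat (R : Type u) [CommRing R] (n : ℕ)
    (M : Type u) [AddCommGroup M] [Module R M] : Prop :=
  ∀ (K L : Type u) [AddCommGroup K] [Module R K] [AddCommGroup L] [Module R L],
    IsFinitelyNPresented R n K → IsFinitelyNPresented R n L →
    ∀ f : K →ₗ[R] L, Function.Injective f → Function.Injective (LinearMap.rTensor M f)

/-- `M` has a projective resolution `⋯ ⟶ P_1 ⟶ P_0 ⟶ M ⟶ 0` by finitely generated projective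
modules. -/
def HasDegreewiseFiniteProjectiveResolution (R : Type u) [CommRing R]
    (M : Type u) [AddCommGroup M] [Module R M] : Prop :=
  ∃ (P : ℕ → ModuleCat.{u} R) (d : ∀ i, P (i + 1) →ₗ[R] P i) (ε : P 0 →ₗ[R] M),
    (∀ i, Module.Finite R (P i) ∧ Module.Projective R (P i)) ∧
    Function.Surjective ε ∧
    Function.Exact (d 0) ε ∧
    ∀ i, Function.Exact (d (i + 1)) (d i)

/-- `C` is a semidualizing module over the commutative ring `R` (with the same action of `R` on
both sides, so that the left and right conditions coincide). -/
structure IsSemidualizing (R : Type u) [CommRing R]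
    (C : Type u) [AddCommGroup C] [Module R C] : Prop where
  resolution : HasDegreewiseFiniteProjectiveResolution R C
  /-- The homothety map `R ⟶ Hom(C, C)`, `r ↦ (c ↦ r • c)`, is an isomorphism. -/
  homothety : Function.Bijective (LinearMap.lsmul R C : R →ₗ[R] (C →ₗ[R] C))
  ext_eq_zero : ∀ i : ℕ, 1 ≤ i →
    Subsingleton (CategoryTheory.Abelian.Ext (ModuleCat.of R C) (ModuleCat.of R C) i)

/-- `M` belongs to `Cfp_nI(R)`: it has the form `Hom(C, X)` with `X` an `fp_n`-injective module. -/
def IsCFpInjective (R : Type u) [CommRing R] (C : Type u) [AddCommGroup C] [Module R C] (n : ℕ)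
    (M : Type u) [AddCommGroup M] [Module R M] : Prop :=
  ∃ (X : Type u) (_ : AddCommGroup X) (_ : Module R X),
    IsFpInjective R n X ∧ Nonempty (M ≃ₗ[R] (C →ₗ[R] X))

/-- `M` belongs to `Cfp_nF(R)`: it has the form `C ⊗ Y` with `Y` an `fp_n`-flat module. -/
def IsCFpFlat (R : Type u) [CommRing R] (C : Type u) [AddCommGroup C] [Module R C] (n : ℕ)
    (M : Type u) [AddCommGroup M] [Module R M] : Prop :=
  ∃ (Y : Type u) (_ : AddCommGroup Y) (_ : Module R Y),
    IsFpFlat R n Y ∧ Nonempty (M ≃ₗ[R] TensorProduct R C Y)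

/-- `f : M ⟶ F` is an `𝓕`-preenvelope of `M`. -/
def IsPreenvelope {R : Type u} [CommRing R]
    (𝓕 : ∀ (F : Type u) [AddCommGroup F] [Module R F], Prop)
    {M F : Type u} [AddCommGroup M] [Module R M] [AddCommGroup F] [Module R F]
    (f : M →ₗ[R] F) : Prop :=
  𝓕 F ∧ ∀ (F' : Type u) [AddCommGroup F'] [Module R F'], 𝓕 F' →
    Function.Surjective (fun h : F →ₗ[R] F' => h ∘ₗ f)

/-- `f : F ⟶ M` is an `𝓕`-precover of `M`. -/
def IsPrecover {R : Type u} [CommRing R]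
    (𝓕 : ∀ (F : Type u) [AddCommGroup F] [Module R F], Prop)
    {M F : Type u} [AddCommGroup M] [Module R M] [AddCommGroup F] [Module R F]
    (f : F →ₗ[R] M) : Prop :=
  𝓕 F ∧ ∀ (F' : Type u) [AddCommGroup F'] [Module R F'], 𝓕 F' →
    Function.Surjective (fun h : F' →ₗ[R] F => f ∘ₗ h)

/-- `f : F ⟶ M` is an `𝓕`-cover of `M`: a precover such that every endomorphism `g` of `F` with
`f g = f` is an isomorphism. -/
def IsCover {R : Type u} [CommRing R]
    (𝓕 : ∀ (F : Type u) [AddCommGroup F] [Module R F], Prop)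
    {M F : Type u} [AddCommGroup M] [Module R M] [AddCommGroup F] [Module R F]
    (f : F →ₗ[R] M) : Prop :=
  IsPrecover 𝓕 f ∧ ∀ g : F →ₗ[R] F, f ∘ₗ g = f → Function.Bijective g

/-! Everything rests on two facts about the adjoint pair `C ⊗ -` and `Hom(C, -)`.

The first is that the counit is bijective at every fp_n-injective X (`homTensorCounit_bijective`).
Applying Hom(-, C) to a finite presentation of C and using Hom(C, C) = R gives an exact sequence 0 →
R → C^k → C^l. The modules R, C^k, C^l and C^k / R are finitely n-presented, so Hom(-, X) keeps this
sequence exact, and the resulting statement is that C ⊗ Hom(C, X) → X is an isomorphism. Character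
duality turns this into bijectivity of the unit at fp_n-flat modules. Membership in either class
thereby becomes a property of the module itself (`isCFpInjective_iff`, `isCFpFlat_iff`), and a
module lies in one class exactly when its character module lies in the other.

The classes are then closed under retracts; Cfp_nF is closed under products and pure submodules,
Cfp_nI under direct sums and pure quotients. Together with cardinality bounds, this yields
Cfp_nF-preenvelopes and Cfp_nI-precovers. A directed colimit is a pure quotient of a direct sum, so
Cfp_nI is closed under directed colimits, and a transfinite argument refines precovers to covers.

Once these approximations exist, each condition only says that R is in Cfp_nI. If it is, so is every
flat module, every injective module is in Cfp_nF, and every module embeds in a member of Cfp_nF.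
Conversely R, or its character module, is a retract of a module supplied by each condition, or is
recovered from one by duality. -/

section Presentations

/-! ### Finite presentations in coordinates: generators and a relation matrix. -/

open TensorProduct

variable {R : Type u} [CommRing R]

/-- The family `c` generates `K`, and the relations between its members are generated by the rows
of the matrix `A`. -/
structure IsPresentedBy {K : Type u} [AddCommGroup K] [Module R K] {k l : ℕ}
    (c : Fin k → K) (A : Fin l → Fin k → R) : Prop where
  span_eq_top : Submodule.span R (Set.range c) = ⊤
  rel : ∀ j, ∑ i, A j i • c i = 0
  exact : ∀ r : Fin k → R, ∑ i, r i • c i = 0 → ∃ w : Fin l → R, ∀ i, r i = ∑ j, w j * A j i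

theorem exists_isPresentedBy (K : Type u) [AddCommGroup K] [Module R K]
    [Module.FinitePresentation R K] :
    ∃ (k l : ℕ) (c : Fin k → K) (A : Fin l → Fin k → R), IsPresentedBy c A := by
  obtain ⟨k, l, f, g, hf, hfg⟩ := Module.FinitePresentation.exists_fin' R K
  have hfx (x : Fin k → R) : f x = ∑ i, x i • f (Pi.single i 1) := by
    conv_lhs => rw [← LinearMap.sum_single_apply (fun _ : Fin k => R) x]
    simp only [map_sum]
    refine Finset.sum_congr rfl fun i _ => ?_
    rw [← map_smul, ← Pi.single_smul', smul_eq_mul, mul_one]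
  refine ⟨k, l, fun i => f (Pi.single i 1), fun j => g (Pi.single j 1), ?_, fun j => ?_,
    fun r hr => ?_⟩
  · rw [eq_top_iff]
    rintro y -
    obtain ⟨x, rfl⟩ := hf y
    rw [hfx]
    exact Submodule.sum_mem _ fun i _ => Submodule.smul_mem _ _ (Submodule.subset_span ⟨i, rfl⟩)
  · rw [← hfx]
    exact hfg.apply_apply_eq_zero _
  · rw [← hfx] at hr
    obtain ⟨w, rfl⟩ := (hfg r).1 hr
    refine ⟨w, fun i => ?_⟩
    conv_lhs => rw [← LinearMap.sum_single_apply (fun _ : Fin l => R) w]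
    rw [map_sum, Finset.sum_apply]
    refine Finset.sum_congr rfl fun j _ => ?_
    rw [← smul_eq_mul, ← Pi.smul_apply, ← map_smul, ← Pi.single_smul', smul_eq_mul, mul_one]

namespace IsPresentedBy

variable {K X : Type u} [AddCommGroup K] [Module R K] [AddCommGroup X] [Module R X]
  {k l : ℕ} {c : Fin k → K} {A : Fin l → Fin k → R}

theorem exists_eq_sum (h : IsPresentedBy c A) (x : K) : ∃ r : Fin k → R, x = ∑ i, r i • c i := by
  have : x ∈ Submodule.span R (Set.range c) := h.span_eq_top ▸ Submodule.mem_top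
  obtain ⟨r, hr⟩ := (Submodule.mem_span_range_iff_exists_fun R).1 this
  exact ⟨r, hr.symm⟩

theorem exists_hom (h : IsPresentedBy c A) (x : Fin k → X) (hx : ∀ j, ∑ i, A j i • x i = 0) :
    ∃ f : K →ₗ[R] X, ∀ i, f (c i) = x i := by
  let p : (Fin k → R) →ₗ[R] K := Fintype.linearCombination R c
  have hp : Function.Surjective p := by
    intro y
    obtain ⟨r, rfl⟩ := h.exists_eq_sum y
    exact ⟨r, rfl⟩
  let q : (Fin k → R) →ₗ[R] X := Fintype.linearCombination R x
  have hker : LinearMap.ker p ≤ LinearMap.ker q := by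
    intro r hr
    obtain ⟨w, hw⟩ := h.exact r hr
    change ∑ i, r i • x i = 0
    simp only [hw, Finset.sum_smul, mul_smul]
    rw [Finset.sum_comm]
    simp only [← Finset.smul_sum, hx, smul_zero, Finset.sum_const_zero]
  let e := p.quotKerEquivOfSurjective hp
  refine ⟨(LinearMap.ker p).liftQ q hker ∘ₗ e.symm.toLinearMap, fun i => ?_⟩
  have hci : c i = e (Submodule.Quotient.mk (Pi.single i 1)) := by
    change c i = p (Pi.single i 1)
    simp [p, Fintype.linearCombination_apply, Pi.single_apply]
  rw [hci]
  simp [q, Fintype.linearCombination_apply, Pi.single_apply]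

theorem exists_tmul_eq (h : IsPresentedBy c A) (t : K ⊗[R] X) :
    ∃ y : Fin k → X, t = ∑ i, c i ⊗ₜ y i := by
  induction t with
  | zero => exact ⟨0, by simp⟩
  | tmul a x =>
    obtain ⟨r, rfl⟩ := h.exists_eq_sum a
    exact ⟨fun i => r i • x, by simp only [sum_tmul, smul_tmul]⟩
  | add s t hs ht =>
    obtain ⟨y, rfl⟩ := hs
    obtain ⟨z, rfl⟩ := ht
    exact ⟨y + z, by simp only [Pi.add_apply, tmul_add, Finset.sum_add_distrib]⟩

/-- Right exactness of the tensor product in coordinates: K ⊗ X is the cokernel of the transpose of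
A from X^l to X^k. Dually, `exists_hom` makes Hom(K, X) the kernel of A from X^k to X^l. -/
theorem sum_tmul_eq_zero_iff (h : IsPresentedBy c A) (y : Fin k → X) :
    ∑ i, c i ⊗ₜ[R] y i = 0 ↔ ∃ z : Fin l → X, ∀ i, y i = ∑ j, A j i • z j := by
  constructor
  · intro hy
    obtain ⟨m, a, y', hy', ha⟩ := vanishesTrivially_of_sum_tmul_eq_zero R h.span_eq_top hy
    choose w hw using fun s => h.exact (fun i => a i s) (ha s)
    refine ⟨fun j => ∑ s, w s j • y' s, fun i => ?_⟩
    rw [hy' i]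
    simp only [hw, Finset.sum_smul, Finset.smul_sum]
    rw [Finset.sum_comm]
    simp only [smul_smul, mul_comm]
  · rintro ⟨z, hz⟩
    simp only [hz, tmul_sum]
    rw [Finset.sum_comm]
    refine Finset.sum_eq_zero fun j _ => ?_
    simp only [← smul_tmul, ← sum_tmul, h.rel, zero_tmul]

end IsPresentedBy

end Presentations

/-! ### Finitely n-presented modules and short exact sequences. -/

section FinitelyNPresented

variable {R : Type u} [CommRing R]

theorem isFinitelyNPresented_zero_iff {M : Type u} [AddCommGroup M] [Module R M] :
    IsFinitelyNPresented R 0 M ↔ Module.Finite R M := by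
  constructor
  · rintro ⟨k, -, ε, hε, -⟩
    exact Module.Finite.of_surjective ε hε
  · intro h
    obtain ⟨k, f, hf⟩ := Module.Finite.exists_fin' R M
    exact ⟨fun _ => k, fun _ => 0, f, hf, by simp, by simp⟩

theorem isFinitelyNPresented_succ_iff {n : ℕ} {M : Type u} [AddCommGroup M] [Module R M] :
    IsFinitelyNPresented R (n + 1) M ↔
      ∃ (k : ℕ) (f : (Fin k → R) →ₗ[R] M), Function.Surjective f ∧
        IsFinitelyNPresented R n (LinearMap.ker f) := by
  constructor
  · rintro ⟨k, d, ε, hε, h0, h⟩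
    have hd : ∀ x, d 0 x ∈ LinearMap.ker ε := (h0 n.succ_pos).apply_apply_eq_zero
    refine ⟨k 0, ε, hε, fun i => k (i + 1), fun i => d (i + 1), (d 0).codRestrict _ hd, ?_, ?_, ?_⟩
    · rintro ⟨y, hy⟩
      obtain ⟨x, rfl⟩ := (h0 n.succ_pos y).1 hy
      exact ⟨x, rfl⟩
    · intro hn x
      rw [← h 0 (by omega) x, ← Subtype.coe_inj]
      rfl
    · exact fun i hi => h (i + 1) (by omega)
  · rintro ⟨m, f, hf, k, d, ε, hε, h0, h⟩
    refine ⟨fun i => Nat.casesOn i m k,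
      fun i => Nat.casesOn i ((LinearMap.ker f).subtype ∘ₗ ε) d, f, hf, fun _ y => ?_, fun i hi => ?_⟩
    · constructor
      · intro hy
        obtain ⟨x, hx⟩ := hε ⟨y, hy⟩
        exact ⟨x, congrArg Subtype.val hx⟩
      · rintro ⟨x, rfl⟩
        exact (ε x).2
    · cases i with
      | zero =>
        intro y
        refine Iff.trans ?_ (h0 (by omega) y)
        exact Subtype.coe_inj (b := (0 : LinearMap.ker f))
      | succ i => exact h i (by omega)

theorem IsFinitelyNPresented.finitePresentation {n : ℕ} (hn : 0 < n) {M : Type u} [AddCommGroup M]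
    [Module R M] (h : IsFinitelyNPresented R n M) : Module.FinitePresentation R M := by
  obtain ⟨m, rfl⟩ : ∃ m, n = m + 1 := ⟨n - 1, by omega⟩
  obtain ⟨k, d, ε, hε, h0, -⟩ := h
  refine Module.finitePresentation_of_surjective ε hε ?_
  rw [(LinearMap.exact_iff).1 (h0 m.succ_pos)]
  exact (Module.Finite.iff_fg).1 inferInstance

theorem IsFinitelyNPresented.of_equiv {n : ℕ} {M N : Type u} [AddCommGroup M] [Module R M]
    [AddCommGroup N] [Module R N] (e : M ≃ₗ[R] N) (h : IsFinitelyNPresented R n M) :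
    IsFinitelyNPresented R n N := by
  obtain ⟨k, d, ε, hε, h0, h⟩ := h
  refine ⟨k, d, e.toLinearMap ∘ₗ ε, e.surjective.comp hε, fun hn x => ?_, h⟩
  rw [← h0 hn x]
  simp

/-- Horseshoe argument: free covers of X and Z combine into one of Y whose kernel is again an
extension, of ker q by ker p, so induction on n applies. -/
theorem IsFinitelyNPresented.extension {n : ℕ} : ∀ {X Y Z : Type u} [AddCommGroup X] [Module R X]
    [AddCommGroup Y] [Module R Y] [AddCommGroup Z] [Module R Z] (f : X →ₗ[R] Y) (g : Y →ₗ[R] Z),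
    Function.Injective f → Function.Exact f g → Function.Surjective g →
    IsFinitelyNPresented R n X → IsFinitelyNPresented R n Z → IsFinitelyNPresented R n Y := by
  induction n with
  | zero =>
    intro X Y Z _ _ _ _ _ _ f g _ hfg hg hX hZ
    rw [isFinitelyNPresented_zero_iff] at *
    refine ⟨Submodule.fg_of_fg_map_of_fg_inf_ker g ?_ ?_⟩
    · rw [Submodule.map_top, LinearMap.range_eq_top.2 hg]
      exact hZ.fg_top
    · rw [top_inf_eq, (LinearMap.exact_iff).1 hfg]
      exact (Module.Finite.iff_fg).1 inferInstance
  | succ n ih =>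
    intro X Y Z _ _ _ _ _ _ f g hf hfg hg hX hZ
    rw [isFinitelyNPresented_succ_iff] at *
    obtain ⟨a, p, hp, hpk⟩ := hX
    obtain ⟨b, q, hq, hqk⟩ := hZ
    obtain ⟨q', hq'⟩ := Module.projective_lifting_property g q hg
    have hgq (v) : g (q' v) = q v := LinearMap.congr_fun hq' v
    have hgf (x) : g (f x) = 0 := hfg.apply_apply_eq_zero x
    let s : ((Fin a → R) × (Fin b → R)) →ₗ[R] Y := (f ∘ₗ p).coprod q'
    have hs : Function.Surjective s := by
      intro y
      obtain ⟨v, hv⟩ := hq (g y)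
      obtain ⟨x, hx⟩ := (hfg (y - q' v)).1 (by rw [map_sub, hgq, hv, sub_self])
      obtain ⟨w, rfl⟩ := hp x
      exact ⟨(w, v), by simp [s, hx]⟩
    let e : (Fin (a + b) → R) ≃ₗ[R] ((Fin a → R) × (Fin b → R)) :=
      (LinearEquiv.funCongrLeft R R finSumFinEquiv).trans
        (LinearEquiv.sumArrowLequivProdArrow (Fin a) (Fin b) R R)
    refine ⟨a + b, s ∘ₗ e.toLinearMap, hs.comp e.surjective, ?_⟩
    have hker : IsFinitelyNPresented R n (LinearMap.ker s) := by
      let i : LinearMap.ker p →ₗ[R] LinearMap.ker s :=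
        ((LinearMap.inl R (Fin a → R) (Fin b → R)) ∘ₗ (LinearMap.ker p).subtype).codRestrict _
          (fun x => by simp [s])
      let j : LinearMap.ker s →ₗ[R] LinearMap.ker q :=
        ((LinearMap.snd R (Fin a → R) (Fin b → R)) ∘ₗ (LinearMap.ker s).subtype).codRestrict _
          (fun x => by
            have h : g (f (p x.1.1) + q' x.1.2) = 0 := by
              rw [show f (p x.1.1) + q' x.1.2 = 0 from x.2, map_zero]
            rwa [map_add, hgf, hgq, zero_add] at h)
      refine ih i j ?_ ?_ ?_ hpk hqk
      · intro x y hxy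
        have := congrArg (fun t : LinearMap.ker s => t.1.1) hxy
        exact Subtype.ext this
      · intro x
        constructor
        · intro hx
          have h2 : x.1.2 = 0 := congrArg Subtype.val hx
          have h1 : f (p x.1.1) + q' x.1.2 = 0 := x.2
          rw [h2, map_zero, add_zero] at h1
          have h3 : p x.1.1 = 0 := hf (h1.trans (map_zero f).symm)
          exact ⟨⟨x.1.1, h3⟩, Subtype.ext (Prod.ext rfl h2.symm)⟩
        · rintro ⟨y, rfl⟩
          rfl
      · rintro ⟨v, hv⟩
        have hv' : g (q' v) = 0 := (hgq v).trans hv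
        obtain ⟨x, hx⟩ := (hfg _).1 hv'
        obtain ⟨w, rfl⟩ := hp x
        exact ⟨⟨(-w, v), by simp [s, hx]⟩, rfl⟩
    refine hker.of_equiv ?_
    exact (LinearEquiv.ofSubmodule' e (LinearMap.ker s)).symm

/-- The kernel of R^k → Y → Z is an extension of X by the kernel of R^k → Y, which explains why X
needs one degree less than Y. -/
theorem IsFinitelyNPresented.cokernel {n : ℕ} {X Y Z : Type u} [AddCommGroup X] [Module R X]
    [AddCommGroup Y] [Module R Y] [AddCommGroup Z] [Module R Z] (f : X →ₗ[R] Y) (g : Y →ₗ[R] Z)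
    (hf : Function.Injective f) (hfg : Function.Exact f g) (hg : Function.Surjective g)
    (hX : IsFinitelyNPresented R n X) (hY : IsFinitelyNPresented R (n + 1) Y) :
    IsFinitelyNPresented R (n + 1) Z := by
  rw [isFinitelyNPresented_succ_iff] at *
  obtain ⟨k, p, hp, hpk⟩ := hY
  refine ⟨k, g ∘ₗ p, hg.comp hp, ?_⟩
  let i : LinearMap.ker p →ₗ[R] LinearMap.ker (g ∘ₗ p) :=
    Submodule.inclusion (LinearMap.ker_le_ker_comp p g)
  have hmem (x : LinearMap.ker (g ∘ₗ p)) : p x ∈ LinearMap.range f := (hfg _).1 x.2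
  let j : LinearMap.ker (g ∘ₗ p) →ₗ[R] X :=
    (LinearEquiv.ofInjective f hf).symm.toLinearMap ∘ₗ
      (p ∘ₗ (LinearMap.ker (g ∘ₗ p)).subtype).codRestrict _ hmem
  have hj (x) : f (j x) = p x :=
    congrArg Subtype.val ((LinearEquiv.ofInjective f hf).apply_symm_apply ⟨p x, hmem x⟩)
  refine IsFinitelyNPresented.extension i j (Submodule.inclusion_injective _) ?_ ?_ hpk hX
  · intro x
    constructor
    · intro hx
      have : p x = 0 := by rw [← hj, hx, map_zero]
      exact ⟨⟨x, this⟩, rfl⟩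
    · rintro ⟨y, rfl⟩
      apply hf
      rw [hj, map_zero]
      exact y.2
  · intro x
    obtain ⟨v, hv⟩ := hp (f x)
    refine ⟨⟨v, ?_⟩, hf ?_⟩
    · change g (p v) = 0
      rw [hv]
      exact hfg.apply_apply_eq_zero x
    · rw [hj, hv]

theorem isFinitelyNPresented_free (n k : ℕ) : IsFinitelyNPresented R n (Fin k → R) := by
  refine ⟨fun i => Nat.casesOn i k fun _ => 0, fun _ => 0, LinearMap.id, fun x => ⟨x, rfl⟩,
    fun _ x => ?_, fun i _ x => ?_⟩
  · constructor
    · rintro rfl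
      exact ⟨0, rfl⟩
    · rintro ⟨y, rfl⟩
      rfl
  · exact ⟨fun _ => ⟨0, funext fun t => t.elim0⟩, fun _ => rfl⟩

theorem isFinitelyNPresented_ring (n : ℕ) : IsFinitelyNPresented R n R :=
  (isFinitelyNPresented_free n 1).of_equiv (LinearEquiv.funUnique (Fin 1) R R)

theorem isFinitelyNPresented_of_projective (n : ℕ) : ∀ (P : Type u) [AddCommGroup P] [Module R P]
    [Module.Finite R P] [Module.Projective R P], IsFinitelyNPresented R n P := by
  induction n with
  | zero => exact fun P _ _ _ _ => isFinitelyNPresented_zero_iff.2 inferInstance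
  | succ n ih =>
    intro P _ _ _ _
    obtain ⟨k, f, hf⟩ := Module.Finite.exists_fin' R P
    obtain ⟨g, hg⟩ := Module.projective_lifting_property f LinearMap.id hf
    have hfg (x) : f (g x) = x := LinearMap.congr_fun hg x
    -- The projection along the splitting g: the kernel is a summand of R^k, hence finitely
    -- generated projective, and the induction continues.
    let r : (Fin k → R) →ₗ[R] LinearMap.ker f :=
      (LinearMap.id - g ∘ₗ f).codRestrict _ (fun x => by simp [hfg])
    have hr (x : LinearMap.ker f) : r x = x := Subtype.ext (by simp [r])
    have : Module.Finite R (LinearMap.ker f) := Module.Finite.of_surjective r fun x => ⟨x, hr x⟩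
    have : Module.Projective R (LinearMap.ker f) :=
      Module.Projective.of_split (LinearMap.ker f).subtype r (LinearMap.ext hr)
    exact isFinitelyNPresented_succ_iff.2 ⟨k, f, hf, ih _⟩

theorem HasDegreewiseFiniteProjectiveResolution.exists_kernel {M : Type u} [AddCommGroup M]
    [Module R M] (h : HasDegreewiseFiniteProjectiveResolution R M) :
    ∃ (P : Type u) (_ : AddCommGroup P) (_ : Module R P) (f : P →ₗ[R] M), Module.Finite R P ∧
      Module.Projective R P ∧ Function.Surjective f ∧
      HasDegreewiseFiniteProjectiveResolution R (LinearMap.ker f) := by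
  obtain ⟨P, d, ε, hP, hε, h0, h⟩ := h
  have hd : ∀ x, d 0 x ∈ LinearMap.ker ε := h0.apply_apply_eq_zero
  refine ⟨P 0, inferInstance, inferInstance, ε, (hP 0).1, (hP 0).2, hε, fun i => P (i + 1),
    fun i => d (i + 1), (d 0).codRestrict _ hd, fun i => hP (i + 1), ?_, fun x => ?_,
    fun i => h (i + 1)⟩
  · rintro ⟨y, hy⟩
    obtain ⟨x, rfl⟩ := (h0 y).1 hy
    exact ⟨x, rfl⟩
  · rw [← h 0 x, ← Subtype.coe_inj]
    rfl

theorem HasDegreewiseFiniteProjectiveResolution.isFinitelyNPresented (n : ℕ) :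
    ∀ {M : Type u} [AddCommGroup M] [Module R M], HasDegreewiseFiniteProjectiveResolution R M →
      IsFinitelyNPresented R n M := by
  induction n with
  | zero =>
    intro M _ _ h
    obtain ⟨P, _, _, f, _, -, hf, -⟩ := h.exists_kernel
    exact isFinitelyNPresented_zero_iff.2 (Module.Finite.of_surjective f hf)
  | succ n ih =>
    intro M _ _ h
    obtain ⟨P, _, _, f, _, _, hf, hker⟩ := h.exists_kernel
    exact IsFinitelyNPresented.cokernel (LinearMap.ker f).subtype f Subtype.val_injective
      (LinearMap.exact_subtype_ker_map f) hf (ih hker) (isFinitelyNPresented_of_projective _ P)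

theorem IsFinitelyNPresented.pi {n : ℕ} {M : Type u} [AddCommGroup M] [Module R M]
    (h : IsFinitelyNPresented R n M) (k : ℕ) : IsFinitelyNPresented R n (Fin k → M) := by
  induction k with
  | zero =>
    exact (isFinitelyNPresented_free n 0).of_equiv
      { (0 : (Fin 0 → R) →ₗ[R] (Fin 0 → M)) with
        invFun := 0
        left_inv := fun _ => funext fun t => t.elim0
        right_inv := fun _ => funext fun t => t.elim0 }
  | succ k ih =>
    refine IsFinitelyNPresented.extension (LinearMap.single R (fun _ : Fin (k + 1) => M) 0)
      (LinearMap.funLeft R M Fin.succ) (Pi.single_injective (M := fun _ => M) 0)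
      (fun x => ?_) (fun x => ?_) h ih
    · constructor
      · intro hx
        refine ⟨x 0, funext fun i => ?_⟩
        refine Fin.cases ?_ (fun i => ?_) i
        · simp
        · have : x i.succ = 0 := congrFun hx i
          simp [this]
      · rintro ⟨y, rfl⟩
        ext i
        simp [LinearMap.funLeft]
    · exact ⟨Fin.cons 0 x, funext fun i => by simp [LinearMap.funLeft]⟩

end FinitelyNPresented

/-! ### Unit, counit and evaluation maps for Hom and tensor. -/

section HomTensor

open TensorProduct

variable {R : Type u} [CommRing R]

/-- The unit `M ⟶ Hom(C, C ⊗ M)` of the tensor-hom adjunction. -/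
noncomputable def homTensorUnit (C M : Type u) [AddCommGroup C] [Module R C] [AddCommGroup M]
    [Module R M] : M →ₗ[R] C →ₗ[R] C ⊗[R] M :=
  (TensorProduct.mk R C M).flip

/-- The counit `C ⊗ Hom(C, N) ⟶ N` of the tensor-hom adjunction. -/
noncomputable def homTensorCounit (C N : Type u) [AddCommGroup C] [Module R C] [AddCommGroup N]
    [Module R N] : C ⊗[R] (C →ₗ[R] N) →ₗ[R] N :=
  TensorProduct.lift (LinearMap.id.flip)

/-- The evaluation map `K ⊗ X⋆ ⟶ Hom(K, X)⋆`. -/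
noncomputable def tensorCharacterToHom (K X : Type u) [AddCommGroup K] [Module R K]
    [AddCommGroup X] [Module R X] :
    K ⊗[R] CharacterModule X →ₗ[R] CharacterModule (K →ₗ[R] X) :=
  TensorProduct.lift
    { toFun := fun k => CharacterModule.dual (LinearMap.applyₗ k)
      map_add' := fun a b => by ext φ h; exact (congrArg φ (map_add h a b)).trans (map_add φ _ _)
      map_smul' := fun r a => by ext φ h; exact congrArg φ (map_smul h r a) }

variable {C K X : Type u} [AddCommGroup C] [Module R C] [AddCommGroup K] [Module R K]
  [AddCommGroup X] [Module R X]

@[simp] theorem homTensorCounit_tmul (c : C) (h : C →ₗ[R] X) :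
    homTensorCounit C X (c ⊗ₜ h) = h c := rfl

theorem character_sum_apply {ι : Type*} {X : Type u} [AddCommGroup X] (s : Finset ι)
    (φ : ι → CharacterModule X) (x : X) : (∑ i ∈ s, φ i) x = ∑ i ∈ s, φ i x :=
  AddMonoidHom.finsetSum_apply φ s x

theorem character_pi_apply {k : ℕ} (φ : CharacterModule (Fin k → X)) (x : Fin k → X) :
    φ x = ∑ i, CharacterModule.dual (LinearMap.single R (fun _ : Fin k => X) i) φ (x i) := by
  conv_lhs => rw [← LinearMap.sum_single_apply (fun _ : Fin k => X) x]
  rw [map_sum]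
  rfl

/-- Dualizing the exact sequence 0 → Hom(K, X) → X^k → X^l, given by a presentation of K, produces
the presentation of K ⊗ X⋆. -/
theorem tensorCharacterToHom_bijective [Module.FinitePresentation R K] :
    Function.Bijective (tensorCharacterToHom (R := R) K X) := by
  obtain ⟨k, l, c, A, hA⟩ := exists_isPresentedBy (R := R) K
  let ev : (K →ₗ[R] X) →ₗ[R] (Fin k → X) := LinearMap.pi fun i => LinearMap.applyₗ (c i)
  have hev : Function.Injective ev := by
    intro f g hfg
    refine LinearMap.ext_on_range hA.span_eq_top fun i => congrFun hfg i
  let a : (Fin k → X) →ₗ[R] (Fin l → X) :=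
    LinearMap.pi fun j => ∑ i, A j i • LinearMap.proj i
  have ha (x j) : a x j = ∑ i, A j i • x i := by simp [a]
  constructor
  · rw [injective_iff_map_eq_zero]
    intro t ht
    obtain ⟨φ, rfl⟩ := hA.exists_tmul_eq t
    rw [hA.sum_tmul_eq_zero_iff]
    have hφ (h : K →ₗ[R] X) : ∑ i, φ i (h (c i)) = 0 := by
      have := DFunLike.congr_fun ht h
      rw [map_sum, character_sum_apply] at this
      exact this
    let Φ : CharacterModule (Fin k → X) := ∑ i, CharacterModule.dual (LinearMap.proj (R := R) i) (φ i)
    have hΦ (x) : Φ x = ∑ i, φ i (x i) := by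
      rw [character_sum_apply]
      rfl
    -- Φ kills ker a = Hom(K, X), so it descends to the image of a and extends to a character Ψ of
    -- X^l. The components of Ψ are the coefficients showing that the tensor vanishes.
    have hker : ∀ x, a x = 0 → Φ x = 0 := by
      intro x hx
      obtain ⟨h, hh⟩ := hA.exists_hom x fun j => (ha x j).symm.trans (congrFun hx j)
      rw [hΦ, ← hφ h]
      simp only [hh]
    let L : ((Fin k → X) ⧸ LinearMap.ker a) →+ AddCircle (1 : ℚ) :=
      QuotientAddGroup.lift _ Φ fun x hx => hker x hx
    let Φ' : CharacterModule (LinearMap.range a) :=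
      L.comp (a.quotKerEquivRange.symm.toLinearMap.toAddMonoidHom)
    have hΦ' (x) : Φ' (a.rangeRestrict x) = Φ x := by
      have : a.quotKerEquivRange.symm (a.rangeRestrict x) = Submodule.Quotient.mk x :=
        (LinearEquiv.symm_apply_eq _).2 rfl
      change L (a.quotKerEquivRange.symm (a.rangeRestrict x)) = _
      rw [this]
      rfl
    obtain ⟨Ψ, hΨ⟩ := CharacterModule.dual_surjective_of_injective
      (LinearMap.range a).subtype Subtype.val_injective Φ'
    have hΨ' (x) : Ψ (a x) = Φ x := by
      rw [← hΦ', ← hΨ]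
      rfl
    refine ⟨fun j => CharacterModule.dual (LinearMap.single R (fun _ : Fin l => X) j) Ψ,
      fun i => ?_⟩
    ext x
    have h1 : Φ (Pi.single i x) = φ i x := by
      rw [hΦ, Finset.sum_eq_single i]
      · simp
      · intro b _ hb
        simp [hb]
      · simp
    rw [← h1, ← hΨ', character_pi_apply (R := R) Ψ]
    rw [character_sum_apply]
    refine Finset.sum_congr rfl fun j _ => ?_
    change _ = CharacterModule.dual (LinearMap.single R (fun _ : Fin l => X) j) Ψ (A j i • x)
    rw [ha, Finset.sum_eq_single i]
    · simp
    · intro b _ hb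
      simp [hb]
    · simp
  · intro ψ
    obtain ⟨Φ, rfl⟩ := CharacterModule.dual_surjective_of_injective ev hev ψ
    refine ⟨∑ i, c i ⊗ₜ CharacterModule.dual (LinearMap.single R (fun _ : Fin k => X) i) Φ, ?_⟩
    ext h
    rw [map_sum, character_sum_apply]
    change _ = Φ (ev h)
    rw [character_pi_apply (R := R) Φ]
    rfl

theorem piRightHom_bijective_of_finitePresentation [Module.FinitePresentation R K] {ι : Type u} (Y : ι → Type u)
    [∀ i, AddCommGroup (Y i)] [∀ i, Module R (Y i)] :
    Function.Bijective (piRightHom R R K Y) := by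
  obtain ⟨k, l, c, A, hA⟩ := exists_isPresentedBy (R := R) K
  constructor
  · rw [injective_iff_map_eq_zero]
    intro t ht
    obtain ⟨y, rfl⟩ := hA.exists_tmul_eq t
    have h (s : ι) : ∑ i, c i ⊗ₜ[R] y i s = 0 := by
      have := congrFun ht s
      rw [map_sum, Finset.sum_apply] at this
      exact this
    choose z hz using fun s => (hA.sum_tmul_eq_zero_iff _).1 (h s)
    exact (hA.sum_tmul_eq_zero_iff _).2 ⟨fun j s => z s j, fun i => funext fun s => by
      rw [hz s i, Finset.sum_apply]
      rfl⟩
  · intro t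
    choose y hy using fun s => hA.exists_tmul_eq (t s)
    refine ⟨∑ i, c i ⊗ₜ fun s => y s i, funext fun s => ?_⟩
    rw [hy s, map_sum, Finset.sum_apply]
    rfl

/-- Extending maps from R to C^k gives surjectivity, and extending maps from C^k / R to C^l gives
injectivity. -/
theorem homTensorCounit_bijective {n : ℕ} (hn : 0 < n) (hC : IsSemidualizing R C)
    (hX : IsFpInjective R n X) : Function.Bijective (homTensorCounit (R := R) C X) := by
  have hCn (m) : IsFinitelyNPresented R m C := hC.resolution.isFinitelyNPresented m
  have := (hCn n).finitePresentation hn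
  obtain ⟨k, l, c, A, hA⟩ := exists_isPresentedBy (R := R) C
  let ι : R →ₗ[R] (Fin k → C) := LinearMap.toSpanSingleton R _ c
  have hι (r i) : ι r i = r • c i := rfl
  have hιinj : Function.Injective ι := by
    rw [injective_iff_map_eq_zero]
    intro r hr
    apply hC.homothety.1
    refine LinearMap.ext_on_range hA.span_eq_top fun i => ?_
    exact by simpa [hι] using congrFun hr i
  let a : (Fin k → C) →ₗ[R] (Fin l → C) :=
    LinearMap.pi fun j => ∑ i, A j i • LinearMap.proj i
  have ha (x j) : a x j = ∑ i, A j i • x i := by simp [a]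
  have haι (r) : a (ι r) = 0 := by
    ext j
    simp only [ha, hι, smul_comm _ r, ← Finset.smul_sum, hA.rel, smul_zero, Pi.zero_apply]
  -- A vector killed by the relations is an endomorphism of C, hence a homothety: 0 → R → C^k → C^l
  -- is exact.
  have hker (x) (hx : a x = 0) : ∃ r, ι r = x := by
    obtain ⟨h, hh⟩ := hA.exists_hom x fun j => (ha x j).symm.trans (congrFun hx j)
    obtain ⟨r, rfl⟩ := hC.homothety.2 h
    exact ⟨r, funext hh⟩
  let Z := (Fin k → C) ⧸ LinearMap.range ι
  let a' : Z →ₗ[R] (Fin l → C) := (LinearMap.range ι).liftQ a (by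
    rintro _ ⟨r, rfl⟩
    exact haι r)
  have ha'inj : Function.Injective a' := by
    rw [injective_iff_map_eq_zero]
    intro z hz
    obtain ⟨x, rfl⟩ := Submodule.Quotient.mk_surjective _ z
    exact (Submodule.Quotient.mk_eq_zero _).2 (hker x hz)
  have hZ : IsFinitelyNPresented R n Z := by
    obtain ⟨m, rfl⟩ : ∃ m, n = m + 1 := ⟨n - 1, by omega⟩
    refine IsFinitelyNPresented.cokernel ι (LinearMap.range ι).mkQ hιinj ?_
      (Submodule.mkQ_surjective _) (isFinitelyNPresented_ring m) ((hCn _).pi k)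
    exact LinearMap.exact_map_mkQ_range ι
  constructor
  · rw [injective_iff_map_eq_zero]
    intro t ht
    obtain ⟨g, rfl⟩ := hA.exists_tmul_eq t
    rw [hA.sum_tmul_eq_zero_iff]
    have hg : ∑ i, g i (c i) = 0 := by simpa using ht
    -- The vanishing of the counit on the tensor says that G is zero on R, so G factors through Z
    -- and extends to C^l. The components of the extension H express g through the relations.
    let G : (Fin k → C) →ₗ[R] X := ∑ i, g i ∘ₗ LinearMap.proj i
    have hG (x) : G x = ∑ i, g i (x i) := by simp [G]
    let G' : Z →ₗ[R] X := (LinearMap.range ι).liftQ G (by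
      rintro _ ⟨r, rfl⟩
      change G (ι r) = 0
      simp only [hG, hι, map_smul, ← Finset.smul_sum, hg, smul_zero])
    obtain ⟨H, hH⟩ := hX _ _ hZ ((hCn n).pi l) a' ha'inj G'
    have hH' (x) : H (a x) = G x := LinearMap.congr_fun hH (Submodule.Quotient.mk x)
    refine ⟨fun j => H ∘ₗ LinearMap.single R (fun _ : Fin l => C) j, fun i => ?_⟩
    ext y
    have h1 : G (Pi.single i y) = g i y := by
      rw [hG, Finset.sum_eq_single i]
      · simp
      · intro b _ hb
        simp [hb]
      · simp
    rw [← h1, ← hH', ← LinearMap.sum_single_apply (fun _ : Fin l => C) (a _), map_sum,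
      LinearMap.sum_apply]
    refine Finset.sum_congr rfl fun j _ => ?_
    rw [ha, Finset.sum_eq_single i]
    · simp [Pi.single_smul']
    · intro b _ hb
      simp [hb]
    · simp
  · intro x
    obtain ⟨G, hG⟩ := hX _ _ (isFinitelyNPresented_ring n) ((hCn n).pi k) ι hιinj
      (LinearMap.toSpanSingleton R X x)
    refine ⟨∑ i, c i ⊗ₜ (G ∘ₗ LinearMap.single R (fun _ : Fin k => C) i), ?_⟩
    have h1 : G (ι 1) = x := by simpa using LinearMap.congr_fun hG 1
    rw [map_sum]
    simp only [homTensorCounit_tmul, LinearMap.comp_apply]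
    rw [← map_sum]
    refine Eq.trans ?_ h1
    congr 1
    refine (LinearMap.sum_single_apply (fun _ : Fin k => C) c).trans ?_
    ext i
    rw [hι, one_smul]

end HomTensor

/-! ### The classes Cfp_nI and Cfp_nF: duality and closure properties. -/

section Classes

open TensorProduct

theorem bijective_of_retract {A B A' B' : Type*} {f : A → B} {f' : A' → B'} {i : A → A'}
    {r : A' → A} {j : B → B'} {s : B' → B} (hri : ∀ a, r (i a) = a) (hsj : ∀ b, s (j b) = b)
    (hij : ∀ a, f' (i a) = j (f a)) (hrs : ∀ a, f (r a) = s (f' a)) (hf' : Function.Bijective f') :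
    Function.Bijective f := by
  constructor
  · intro a b hab
    rw [← hri a, ← hri b]
    congr 1
    apply hf'.1
    rw [hij, hij, hab]
  · intro b
    obtain ⟨a, ha⟩ := hf'.2 (j b)
    exact ⟨r a, by rw [hrs, ha, hsj]⟩

variable {R : Type u} [CommRing R] {n : ℕ} {C M N X Y : Type u} [AddCommGroup C] [Module R C]
  [AddCommGroup M] [Module R M] [AddCommGroup N] [Module R N] [AddCommGroup X] [Module R X]
  [AddCommGroup Y] [Module R Y]

theorem IsFpInjective.of_retract (i : X →ₗ[R] Y) (r : Y →ₗ[R] X) (hri : ∀ x, r (i x) = x)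
    (hY : IsFpInjective R n Y) : IsFpInjective R n X := by
  intro K L _ _ _ _ hK hL f hf h
  obtain ⟨g, hg⟩ := hY K L hK hL f hf (i ∘ₗ h)
  refine ⟨r ∘ₗ g, LinearMap.ext fun x => ?_⟩
  have : g (f x) = i (h x) := LinearMap.congr_fun hg x
  simp [this, hri]

theorem IsFpInjective.of_equiv (e : X ≃ₗ[R] Y) (hX : IsFpInjective R n X) : IsFpInjective R n Y :=
  hX.of_retract e.symm.toLinearMap e.toLinearMap e.apply_symm_apply

theorem IsFpFlat.of_retract (i : X →ₗ[R] Y) (r : Y →ₗ[R] X) (hri : ∀ x, r (i x) = x)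
    (hY : IsFpFlat R n Y) : IsFpFlat R n X := by
  intro K L _ _ _ _ hK hL f hf
  have h := hY K L hK hL f hf
  have hri' : r ∘ₗ i = LinearMap.id := LinearMap.ext hri
  have hinj : Function.Injective (LinearMap.lTensor K i) := by
    refine Function.LeftInverse.injective (g := LinearMap.lTensor K r) fun t => ?_
    rw [← LinearMap.comp_apply, ← LinearMap.lTensor_comp, hri', LinearMap.lTensor_id,
      LinearMap.id_apply]
  refine Function.Injective.of_comp (f := LinearMap.lTensor L i) ?_
  rw [← LinearMap.coe_comp, LinearMap.lTensor_comp_rTensor, ← LinearMap.rTensor_comp_lTensor,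
    LinearMap.coe_comp]
  exact h.comp hinj

theorem IsFpFlat.of_equiv (e : X ≃ₗ[R] Y) (hX : IsFpFlat R n X) : IsFpFlat R n Y :=
  hX.of_retract e.symm.toLinearMap e.toLinearMap e.apply_symm_apply

theorem IsFpFlat.pi {ι : Type u} {Y : ι → Type u} [∀ i, AddCommGroup (Y i)] [∀ i, Module R (Y i)]
    (hn : 0 < n) (h : ∀ i, IsFpFlat R n (Y i)) : IsFpFlat R n (∀ i, Y i) := by
  intro K L _ _ _ _ hK hL f hf
  have := hK.finitePresentation hn
  refine Function.Injective.of_comp (f := piRightHom R R L Y) ?_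
  have : piRightHom R R L Y ∘ₗ LinearMap.rTensor (∀ i, Y i) f =
      (LinearMap.pi fun i => LinearMap.rTensor (Y i) f ∘ₗ LinearMap.proj i) ∘ₗ
        piRightHom R R K Y := TensorProduct.ext' fun _ _ => rfl
  rw [← LinearMap.coe_comp, this, LinearMap.coe_comp]
  refine Function.Injective.comp (fun x y hxy => ?_) (piRightHom_bijective_of_finitePresentation Y).1
  exact funext fun i => h i K L hK hL f hf (congrFun hxy i)

theorem isFpFlat_iff_character : IsFpFlat R n Y ↔ IsFpInjective R n (CharacterModule Y) := by
  unfold IsFpFlat IsFpInjective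
  simp only [rTensor_injective_iff_lcomp_surjective]
  rfl

theorem isFpInjective_iff_character (hn : 0 < n) :
    IsFpInjective R n X ↔ IsFpFlat R n (CharacterModule X) := by
  refine forall_congr' fun K => forall_congr' fun L => forall₄_congr fun _ _ _ _ =>
    forall_congr' fun hK => forall_congr' fun hL => forall_congr' fun f => forall_congr' fun hf => ?_
  have := hK.finitePresentation hn
  have := hL.finitePresentation hn
  have h : tensorCharacterToHom L X ∘ₗ LinearMap.rTensor (CharacterModule X) f =
      CharacterModule.dual (f.lcomp R X) ∘ₗ tensorCharacterToHom K X :=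
    TensorProduct.ext' fun _ _ => rfl
  rw [← (tensorCharacterToHom_bijective (R := R) (K := L) (X := X)).1.of_comp_iff,
    ← LinearMap.coe_comp, h, LinearMap.coe_comp,
    Function.Injective.of_comp_iff' _ (tensorCharacterToHom_bijective (R := R) (K := K) (X := X)),
    CharacterModule.dual_injective_iff_surjective]
  rfl

/-- Up to the isomorphisms Hom(C, M⋆) ≅ (C ⊗ M)⋆ and C ⊗ (C ⊗ M)⋆ ≅ Hom(C, C ⊗ M)⋆, the counit at M⋆
is the dual of the unit at M. -/
theorem homTensorUnit_bijective_iff_character [Module.FinitePresentation R C] :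
    Function.Bijective (homTensorUnit (R := R) C M) ↔
      Function.Bijective (homTensorCounit (R := R) C (CharacterModule M)) := by
  have h : homTensorCounit (R := R) C (CharacterModule M) =
      CharacterModule.dual (homTensorUnit C M) ∘ₗ tensorCharacterToHom C (C ⊗[R] M) ∘ₗ
        (LinearEquiv.lTensor C CharacterModule.homEquiv).toLinearMap :=
    TensorProduct.ext' fun _ _ => rfl
  rw [h, LinearMap.coe_comp, Function.Bijective.of_comp_iff, CharacterModule.dual_bijective_iff_bijective]
  rw [LinearMap.coe_comp]
  exact tensorCharacterToHom_bijective.comp (LinearEquiv.bijective _)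

theorem homTensorCounit_bijective_iff_character [Module.FinitePresentation R C] :
    Function.Bijective (homTensorCounit (R := R) C N) ↔
      Function.Bijective (homTensorUnit (R := R) C (CharacterModule N)) := by
  let e := LinearEquiv.ofBijective (tensorCharacterToHom (R := R) C N)
    tensorCharacterToHom_bijective
  let e' := (LinearEquiv.congrRight (M := C) e).trans CharacterModule.homEquiv
  have h : e'.toLinearMap ∘ₗ homTensorUnit (R := R) C (CharacterModule N) =
      CharacterModule.dual (homTensorCounit (R := R) C N) := by
    refine LinearMap.ext fun ψ => CharacterModule.ext _ fun t => ?_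
    induction t with
    | zero => simp only [map_zero]
    | tmul c h => rfl
    | add s t hs ht => simp only [map_add, hs, ht]
  rw [← CharacterModule.dual_bijective_iff_bijective, ← h, LinearMap.coe_comp]
  exact Function.Bijective.of_comp_iff' e'.bijective _

theorem homTensorUnit_bijective (hn : 0 < n) (hC : IsSemidualizing R C) (hY : IsFpFlat R n Y) :
    Function.Bijective (homTensorUnit (R := R) C Y) := by
  have := (hC.resolution.isFinitelyNPresented n).finitePresentation hn
  rw [homTensorUnit_bijective_iff_character]
  exact homTensorCounit_bijective hn hC (isFpFlat_iff_character.1 hY)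

theorem homTensorUnit_bijective_of_retract (i : M →ₗ[R] N) (r : N →ₗ[R] M)
    (hri : ∀ x, r (i x) = x) (h : Function.Bijective (homTensorUnit (R := R) C N)) :
    Function.Bijective (homTensorUnit (R := R) C M) := by
  have hri' : r ∘ₗ i = LinearMap.id := LinearMap.ext hri
  refine bijective_of_retract (j := fun g => i.lTensor C ∘ₗ g) (s := fun g => r.lTensor C ∘ₗ g)
    hri (fun g => ?_) (fun _ => rfl) (fun _ => rfl) h
  rw [← LinearMap.comp_assoc, ← LinearMap.lTensor_comp, hri', LinearMap.lTensor_id,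
    LinearMap.id_comp]

theorem homTensorCounit_bijective_of_retract (i : M →ₗ[R] N) (r : N →ₗ[R] M)
    (hri : ∀ x, r (i x) = x) (h : Function.Bijective (homTensorCounit (R := R) C N)) :
    Function.Bijective (homTensorCounit (R := R) C M) := by
  have hri' : r ∘ₗ i = LinearMap.id := LinearMap.ext hri
  have hnat {A B : Type u} [AddCommGroup A] [Module R A] [AddCommGroup B] [Module R B]
      (f : A →ₗ[R] B) (t : C ⊗[R] (C →ₗ[R] A)) :
      homTensorCounit C B ((f.compRight R (M := C)).lTensor C t) = f (homTensorCounit C A t) := by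
    induction t with
    | zero => simp only [map_zero]
    | tmul c h => rfl
    | add s t hs ht => simp only [map_add, hs, ht]
  refine bijective_of_retract (i := (i.compRight R (M := C)).lTensor C)
    (r := (r.compRight R (M := C)).lTensor C) (j := i) (s := r)
    (fun t => ?_) hri (hnat i) (hnat r) h
  rw [← LinearMap.comp_apply, ← LinearMap.lTensor_comp]
  have : r.compRight R (M := C) ∘ₗ i.compRight R = LinearMap.id := by
    ext g x
    exact hri _
  rw [this, LinearMap.lTensor_id, LinearMap.id_apply]

/-- If M ≅ Hom(C, X), then X is recovered as C ⊗ M through the counit, and the triangle identity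
makes the unit at M bijective. This intrinsic form, unlike the existential one, passes to retracts
and to character modules. -/
theorem isCFpInjective_iff (hn : 0 < n) (hC : IsSemidualizing R C) :
    IsCFpInjective R C n M ↔
      IsFpInjective R n (C ⊗[R] M) ∧ Function.Bijective (homTensorUnit (R := R) C M) := by
  constructor
  · rintro ⟨X, _, _, hX, ⟨e⟩⟩
    have hb := homTensorCounit_bijective hn hC hX
    have hu : Function.Bijective (homTensorUnit (R := R) C (C →ₗ[R] X)) := by
      let ε := (LinearEquiv.ofBijective _ hb)
      have : (LinearEquiv.congrRight (M := C) ε).toLinearMap ∘ₗ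
          homTensorUnit (R := R) C (C →ₗ[R] X) = LinearMap.id := rfl
      rw [← Function.Bijective.of_comp_iff' (LinearEquiv.congrRight (M := C) ε).bijective]
      exact Function.bijective_id
    refine ⟨hX.of_equiv ((LinearEquiv.lTensor C e).trans (LinearEquiv.ofBijective _ hb)).symm, ?_⟩
    exact homTensorUnit_bijective_of_retract e.toLinearMap e.symm.toLinearMap e.symm_apply_apply hu
  · rintro ⟨h1, h2⟩
    exact ⟨_, _, _, h1, ⟨LinearEquiv.ofBijective _ h2⟩⟩

theorem isCFpFlat_iff (hn : 0 < n) (hC : IsSemidualizing R C) :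
    IsCFpFlat R C n N ↔
      IsFpFlat R n (C →ₗ[R] N) ∧ Function.Bijective (homTensorCounit (R := R) C N) := by
  constructor
  · rintro ⟨Y, _, _, hY, ⟨e⟩⟩
    have hb := homTensorUnit_bijective hn hC hY
    have hu : Function.Bijective (homTensorCounit (R := R) C (C ⊗[R] Y)) := by
      let η := (LinearEquiv.ofBijective _ hb)
      have : homTensorCounit (R := R) C (C ⊗[R] Y) ∘ₗ (LinearEquiv.lTensor C η).toLinearMap =
          LinearMap.id := TensorProduct.ext' fun _ _ => rfl
      rw [← Function.Bijective.of_comp_iff _ (LinearEquiv.lTensor C η).bijective]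
      rw [← LinearEquiv.coe_coe, ← LinearMap.coe_comp, this]
      exact Function.bijective_id
    refine ⟨hY.of_equiv ((LinearEquiv.ofBijective _ hb).trans
      (LinearEquiv.congrRight (M := C) e.symm)), ?_⟩
    exact homTensorCounit_bijective_of_retract e.toLinearMap e.symm.toLinearMap e.symm_apply_apply hu
  · rintro ⟨h1, h2⟩
    exact ⟨_, _, _, h1, ⟨(LinearEquiv.ofBijective _ h2).symm⟩⟩

theorem isCFpInjective_iff_character (hn : 0 < n) (hC : IsSemidualizing R C) :
    IsCFpInjective R C n M ↔ IsCFpFlat R C n (CharacterModule M) := by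
  have := (hC.resolution.isFinitelyNPresented n).finitePresentation hn
  rw [isCFpInjective_iff hn hC, isCFpFlat_iff hn hC, homTensorUnit_bijective_iff_character,
    isFpInjective_iff_character hn]
  refine and_congr_left fun _ => ?_
  exact ⟨fun h => h.of_equiv CharacterModule.homEquiv.symm,
    fun h => h.of_equiv CharacterModule.homEquiv⟩

theorem isCFpFlat_iff_character (hn : 0 < n) (hC : IsSemidualizing R C) :
    IsCFpFlat R C n N ↔ IsCFpInjective R C n (CharacterModule N) := by
  have := (hC.resolution.isFinitelyNPresented n).finitePresentation hn
  rw [isCFpInjective_iff hn hC, isCFpFlat_iff hn hC, homTensorCounit_bijective_iff_character,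
    isFpFlat_iff_character]
  let e := LinearEquiv.ofBijective (tensorCharacterToHom (R := R) C N)
    tensorCharacterToHom_bijective
  refine and_congr_left fun _ => ?_
  exact ⟨fun h => h.of_equiv e.symm, fun h => h.of_equiv e⟩

theorem IsCFpInjective.of_retract (hn : 0 < n) (hC : IsSemidualizing R C) (i : M →ₗ[R] N)
    (r : N →ₗ[R] M) (hri : ∀ x, r (i x) = x) (h : IsCFpInjective R C n N) :
    IsCFpInjective R C n M := by
  rw [isCFpInjective_iff hn hC] at *
  refine ⟨h.1.of_retract (i.lTensor C) (r.lTensor C) fun t => ?_,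
    homTensorUnit_bijective_of_retract i r hri h.2⟩
  have hri' : r ∘ₗ i = LinearMap.id := LinearMap.ext hri
  rw [← LinearMap.comp_apply, ← LinearMap.lTensor_comp, hri', LinearMap.lTensor_id,
    LinearMap.id_apply]

theorem IsCFpFlat.of_retract (hn : 0 < n) (hC : IsSemidualizing R C) (i : M →ₗ[R] N)
    (r : N →ₗ[R] M) (hri : ∀ x, r (i x) = x) (h : IsCFpFlat R C n N) :
    IsCFpFlat R C n M := by
  rw [isCFpFlat_iff hn hC] at *
  exact ⟨h.1.of_retract (i.compRight R) (r.compRight R) fun t => LinearMap.ext fun x => hri _,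
    homTensorCounit_bijective_of_retract i r hri h.2⟩

theorem IsCFpInjective.of_equiv (e : M ≃ₗ[R] N) (h : IsCFpInjective R C n M) :
    IsCFpInjective R C n N := by
  obtain ⟨X, _, _, hX, ⟨e'⟩⟩ := h
  exact ⟨X, _, _, hX, ⟨e.symm.trans e'⟩⟩

theorem IsCFpFlat.of_equiv (e : M ≃ₗ[R] N) (h : IsCFpFlat R C n M) :
    IsCFpFlat R C n N := by
  obtain ⟨X, _, _, hX, ⟨e'⟩⟩ := h
  exact ⟨X, _, _, hX, ⟨e.symm.trans e'⟩⟩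

theorem IsCFpFlat.pi (hn : 0 < n) (hC : IsSemidualizing R C) {ι : Type u} {N : ι → Type u}
    [∀ i, AddCommGroup (N i)] [∀ i, Module R (N i)] (h : ∀ i, IsCFpFlat R C n (N i)) :
    IsCFpFlat R C n (∀ i, N i) := by
  have := (hC.resolution.isFinitelyNPresented n).finitePresentation hn
  simp only [isCFpFlat_iff hn hC] at *
  let e : (∀ i, C →ₗ[R] N i) ≃ₗ[R] (C →ₗ[R] ∀ i, N i) :=
    { toFun := LinearMap.pi
      map_add' := fun _ _ => rfl
      map_smul' := fun _ _ => rfl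
      invFun := fun f i => LinearMap.proj i ∘ₗ f
      left_inv := fun _ => rfl
      right_inv := fun _ => rfl }
  refine ⟨(IsFpFlat.pi hn fun i => (h i).1).of_equiv e, ?_⟩
  let p := LinearEquiv.ofBijective (piRightHom R R C fun i => C →ₗ[R] N i)
    (piRightHom_bijective_of_finitePresentation _)
  let q := LinearEquiv.piCongrRight fun i => LinearEquiv.ofBijective _ (h i).2
  have : homTensorCounit (R := R) C (∀ i, N i) ∘ₗ (LinearEquiv.lTensor C e).toLinearMap =
      (p.trans q).toLinearMap := TensorProduct.ext' fun _ _ => rfl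
  rw [← Function.Bijective.of_comp_iff _ (LinearEquiv.lTensor C e).bijective]
  rw [← LinearEquiv.coe_coe, ← LinearMap.coe_comp, this]
  exact (p.trans q).bijective

/-- Characters of a direct sum are families of characters. -/
noncomputable def characterDirectSumEquiv {ι : Type u} (N : ι → Type u)
    [∀ i, AddCommGroup (N i)] [∀ i, Module R (N i)] :
    CharacterModule (DirectSum ι N) ≃ₗ[R] ∀ i, CharacterModule (N i) := by
  classical
  exact LinearEquiv.ofBijective
    (LinearMap.pi fun i => CharacterModule.dual (DirectSum.lof R ι N i))
    ⟨fun φ ψ h => DirectSum.addHom_ext fun i y => DFunLike.congr_fun (congrFun h i) y,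
      fun ψ => ⟨DirectSum.toAddMonoid ψ, funext fun i => CharacterModule.ext _ fun y =>
        DirectSum.toAddMonoid_of _ _ _⟩⟩

theorem IsCFpInjective.directSum (hn : 0 < n) (hC : IsSemidualizing R C) {ι : Type u}
    {N : ι → Type u} [∀ i, AddCommGroup (N i)] [∀ i, Module R (N i)]
    (h : ∀ i, IsCFpInjective R C n (N i)) : IsCFpInjective R C n (DirectSum ι N) := by
  simp only [isCFpInjective_iff_character hn hC] at *
  exact (IsCFpFlat.pi hn hC h).of_equiv (characterDirectSumEquiv N).symm

theorem exists_leftInverse_of_injective {E : Type u} [AddCommGroup E] [Module R E]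
    (hE : Module.Injective R E) (f : E →ₗ[R] M) (hf : Function.Injective f) :
    ∃ r : M →ₗ[R] E, ∀ x, r (f x) = x :=
  hE.out f hf LinearMap.id

/-- For flat M the module M⋆ is injective, so it splits off the dual of a free module mapping onto
M. That free module is a direct sum of copies of R, so its dual is in Cfp_nF. -/
theorem IsCFpInjective.of_flat (hn : 0 < n) (hC : IsSemidualizing R C)
    (h : IsCFpInjective R C n R) [Module.Flat R M] : IsCFpInjective R C n M := by
  classical
  rw [isCFpInjective_iff_character hn hC]
  have hfree : IsCFpInjective R C n (M →₀ R) :=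
    (IsCFpInjective.directSum hn hC fun _ : M => h).of_equiv (finsuppLEquivDirectSum R R M).symm
  have hE : Module.Injective R (CharacterModule M) :=
    Module.Flat.iff_characterModule_injective.1 inferInstance
  obtain ⟨r, hr⟩ := exists_leftInverse_of_injective hE
    (CharacterModule.dual (Finsupp.linearCombination R (id : M → M)))
    (CharacterModule.dual_injective_of_surjective _ (Finsupp.linearCombination_id_surjective R M))
  exact ((isCFpInjective_iff_character hn hC).1 hfree).of_retract hn hC _ r hr

/-- The canonical map from a module to its double character module. -/
noncomputable def toDoubleCharacter (M : Type u) [AddCommGroup M] [Module R M] :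
    M →ₗ[R] CharacterModule (CharacterModule M) where
  toFun m := AddMonoidHom.eval m
  map_add' a b := CharacterModule.ext _ fun φ => map_add φ a b
  map_smul' _ _ := rfl

theorem toDoubleCharacter_injective : Function.Injective (toDoubleCharacter (R := R) M) := by
  rw [injective_iff_map_eq_zero]
  exact fun m hm => CharacterModule.eq_zero_of_character_apply fun c => DFunLike.congr_fun hm c

/-- An injective M splits off the dual of a free module covering M⋆, into which it embeds through
M⋆⋆. -/
theorem IsCFpFlat.of_injective (hn : 0 < n) (hC : IsSemidualizing R C)
    (h : IsCFpInjective R C n R) (hE : Module.Injective R M) : IsCFpFlat R C n M := by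
  let p := Finsupp.linearCombination R (id : CharacterModule M → CharacterModule M)
  obtain ⟨r, hr⟩ := exists_leftInverse_of_injective hE
    (CharacterModule.dual p ∘ₗ toDoubleCharacter M)
    ((CharacterModule.dual_injective_of_surjective _
      (Finsupp.linearCombination_id_surjective R _)).comp toDoubleCharacter_injective)
  refine IsCFpFlat.of_retract hn hC _ r hr ?_
  rw [← isCFpInjective_iff_character hn hC]
  exact IsCFpInjective.of_flat hn hC h

theorem exists_injective_isCFpFlat (hn : 0 < n) (hC : IsSemidualizing R C)
    (h : IsCFpInjective R C n R) (M : Type u) [AddCommGroup M] [Module R M] :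
    ∃ (E : Type u) (_ : AddCommGroup E) (_ : Module R E) (f : M →ₗ[R] E),
      Function.Injective f ∧ IsCFpFlat R C n E := by
  let p := Finsupp.linearCombination R (id : CharacterModule M → CharacterModule M)
  refine ⟨_, _, _, CharacterModule.dual p ∘ₗ toDoubleCharacter M,
    (CharacterModule.dual_injective_of_surjective _
      (Finsupp.linearCombination_id_surjective R _)).comp toDoubleCharacter_injective, ?_⟩
  rw [← isCFpInjective_iff_character hn hC]
  exact IsCFpInjective.of_flat hn hC h

end Classes

/-! ### Pure submodules, their duals, and small pure submodules. -/

section Purity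

open TensorProduct Cardinal

variable {R : Type u} [CommRing R] {M : Type u} [AddCommGroup M] [Module R M]

/-- A submodule is pure if every finite system of linear equations with constants in it that is
solvable in the ambient module is solvable in the submodule. -/
def IsPureSubmodule (P : Submodule R M) : Prop :=
  ∀ (k m : ℕ) (r : Fin k → Fin m → R) (y : Fin m → M), (∀ i, ∑ j, r i j • y j ∈ P) →
    ∃ z : Fin m → M, (∀ j, z j ∈ P) ∧ ∀ i, ∑ j, r i j • z j = ∑ j, r i j • y j

theorem isPureSubmodule_bot : IsPureSubmodule (⊥ : Submodule R M) := fun k m r y hy =>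
  ⟨0, fun _ => Submodule.zero_mem _, fun i => by simpa using ((Submodule.mem_bot R).1 (hy i)).symm⟩

theorem isPureSubmodule_sSup_of_isChain {c : Set (Submodule R M)} (hc : IsChain (· ≤ ·) c)
    (hne : c.Nonempty) (h : ∀ P ∈ c, IsPureSubmodule P) : IsPureSubmodule (sSup c) := by
  intro k m r y hy
  have hdir : DirectedOn (· ≤ ·) c := hc.directedOn
  have : ∃ P ∈ c, ∀ i, ∑ j, r i j • y j ∈ P := by
    simp only [Submodule.mem_sSup_of_directed hne hdir] at hy
    choose P hP hPy using hy
    have hfin : ∀ t : Finset (Fin k), ∃ Q ∈ c, ∀ i ∈ t, P i ≤ Q := by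
      intro t
      induction t using Finset.induction_on with
      | empty => exact ⟨hne.some, hne.some_mem, by simp⟩
      | insert a t _ ih =>
        obtain ⟨Q, hQ, hQt⟩ := ih
        obtain ⟨S, hS, h1, h2⟩ := hdir Q hQ (P a) (hP a)
        refine ⟨S, hS, fun i hi => ?_⟩
        rcases Finset.mem_insert.1 hi with rfl | hi
        · exact h2
        · exact (hQt i hi).trans h1
    obtain ⟨Q, hQ, hQt⟩ := hfin Finset.univ
    exact ⟨Q, hQ, fun i => hQt i (Finset.mem_univ i) (hPy i)⟩
  obtain ⟨P, hP, hPy⟩ := this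
  obtain ⟨z, hz, hzy⟩ := h P hP k m r y hPy
  exact ⟨z, fun j => le_sSup hP (hz j), hzy⟩

theorem IsPureSubmodule.comap_mkQ {P : Submodule R M} (hP : IsPureSubmodule P)
    {Q : Submodule R (M ⧸ P)} (hQ : IsPureSubmodule Q) : IsPureSubmodule (Q.comap P.mkQ) := by
  intro k m r y hy
  obtain ⟨z, hz, hzy⟩ := hQ k m r (fun j => P.mkQ (y j)) (fun i => by simpa using hy i)
  choose w hw using fun j => P.mkQ_surjective (z j)
  obtain ⟨v, hv, hvy⟩ := hP k m r (fun j => y j - w j) (fun i => by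
    rw [← Submodule.Quotient.mk_eq_zero, ← Submodule.mkQ_apply]
    simp only [smul_sub, Finset.sum_sub_distrib, map_sub, map_sum, map_smul, hw, hzy, sub_self])
  refine ⟨fun j => w j + v j, fun j => ?_, fun i => ?_⟩
  · rw [Submodule.mem_comap, map_add, hw, Submodule.mkQ_apply,
      (Submodule.Quotient.mk_eq_zero P).2 (hv j), add_zero]
    exact hz j
  · simp only [smul_add, Finset.sum_add_distrib, hvy i]
    simp only [smul_sub, Finset.sum_sub_distrib, add_sub_cancel]

theorem IsPureSubmodule.lTensor_injective {P : Submodule R M} (hP : IsPureSubmodule P)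
    (T : Type u) [AddCommGroup T] [Module R T] : Function.Injective (P.subtype.lTensor T) := by
  rw [injective_iff_map_eq_zero]
  intro x hx
  obtain ⟨T', hT', hx'⟩ := exists_finite_submodule_left_of_setFinite ({x} : Set (T ⊗[R] P))
    (Set.finite_singleton x)
  obtain ⟨x', rfl⟩ := hx' rfl
  have h0 : LinearMap.rTensor M T'.subtype (P.subtype.lTensor T' x') = 0 := by
    rw [← hx]
    simp only [← LinearMap.comp_apply, LinearMap.lTensor_comp_rTensor,
      LinearMap.rTensor_comp_lTensor]
  -- Vanishing in T ⊗ M already happens over a finitely generated Q ≤ T. There it is witnessed by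
  -- finitely many equations, which purity solves inside P.
  obtain ⟨Q, hQ, hQfg, hQx⟩ := eq_zero_of_fg_of_subtype_eq_zero
    ((Module.Finite.iff_fg).1 hT') h0
  set x'' := LinearMap.rTensor P (Submodule.inclusion hQ) x' with hx''
  have h1 : P.subtype.lTensor Q x'' = 0 := by
    rw [← hQx, hx'']
    simp only [← LinearMap.comp_apply, LinearMap.lTensor_comp_rTensor,
      LinearMap.rTensor_comp_lTensor]
  have h2 : LinearMap.rTensor P T'.subtype x' = LinearMap.rTensor P Q.subtype x'' := by
    rw [hx'', ← LinearMap.comp_apply, ← LinearMap.rTensor_comp]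
    rfl
  suffices hs : x'' = 0 by rw [h2, hs, map_zero]
  have hQfin : Module.Finite R Q := (Module.Finite.iff_fg).2 hQfg
  obtain ⟨k, s, hs⟩ := Module.Finite.exists_fin (R := R) (M := Q)
  have hrep : ∀ t : Q ⊗[R] P, ∃ y : Fin k → P, t = ∑ i, s i ⊗ₜ y i := by
    intro t
    induction t with
    | zero => exact ⟨0, by simp⟩
    | tmul a p =>
      have : a ∈ Submodule.span R (Set.range s) := hs ▸ Submodule.mem_top
      obtain ⟨r, rfl⟩ := (Submodule.mem_span_range_iff_exists_fun R).1 this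
      exact ⟨fun i => r i • p, by simp only [sum_tmul, smul_tmul]⟩
    | add a b ha hb =>
      obtain ⟨y, rfl⟩ := ha
      obtain ⟨z, rfl⟩ := hb
      exact ⟨y + z, by simp only [Pi.add_apply, tmul_add, Finset.sum_add_distrib]⟩
  obtain ⟨y, hy⟩ := hrep x''
  rw [hy] at h1 ⊢
  have h3 : ∑ i, s i ⊗ₜ[R] (y i : M) = 0 := by simpa using h1
  obtain ⟨m, a, z, hz, ha⟩ := vanishesTrivially_of_sum_tmul_eq_zero R hs h3
  obtain ⟨w, hw, hwz⟩ := hP k m a z (fun i => by rw [← hz]; exact (y i).2)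
  refine sum_tmul_eq_zero_of_vanishesTrivially R ⟨m, a, fun j => ⟨w j, hw j⟩, fun i => ?_, ha⟩
  refine Subtype.ext ?_
  refine (hz i).trans ?_
  rw [← hwz]
  simp

/-- Purity makes P ⊗ P⋆ → M ⊗ P⋆ injective, so P → P⋆⋆ extends to M → P⋆⋆; transposing this
extension gives the section. -/
theorem IsPureSubmodule.exists_section {P : Submodule R M} (hP : IsPureSubmodule P) :
    ∃ s : CharacterModule P →ₗ[R] CharacterModule M,
      ∀ φ, CharacterModule.dual P.subtype (s φ) = φ := by
  have h : Function.Injective (P.subtype.rTensor (CharacterModule P)) := by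
    intro x y hxy
    apply (TensorProduct.comm R P (CharacterModule P)).injective
    apply hP.lTensor_injective
    rw [← LinearMap.comm_comp_rTensor_comp_comm_eq] at *
    simp [hxy]
  rw [rTensor_injective_iff_lcomp_surjective] at h
  obtain ⟨g, hg⟩ := h (toDoubleCharacter P)
  refine ⟨(CharacterModule.curry ∘ₗ CharacterModule.dual
    (TensorProduct.comm R (CharacterModule P) M).toLinearMap) (CharacterModule.uncurry g),
    fun φ => CharacterModule.ext _ fun x => ?_⟩
  exact DFunLike.congr_fun (LinearMap.congr_fun hg x) φ

theorem IsPureSubmodule.exists_retraction {P : Submodule R M} (hP : IsPureSubmodule P) :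
    ∃ r : CharacterModule M →ₗ[R] CharacterModule (M ⧸ P),
      ∀ φ, r (CharacterModule.dual P.mkQ φ) = φ := by
  obtain ⟨s, hs⟩ := hP.exists_section
  -- Subtracting the section of the restriction leaves a character trivial on P, that is, a
  -- character of M ⧸ P.
  let t : CharacterModule M →ₗ[R] CharacterModule M :=
    LinearMap.id - s ∘ₗ CharacterModule.dual P.subtype
  have ht (φ) : P.toAddSubgroup ≤ AddMonoidHom.ker (t φ : M →+ AddCircle (1 : ℚ)) := by
    intro x hx
    have : CharacterModule.dual P.subtype (t φ) = 0 := by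
      simp only [t, LinearMap.sub_apply, map_sub, LinearMap.comp_apply, hs, LinearMap.id_apply,
        sub_self]
    exact DFunLike.congr_fun this ⟨x, hx⟩
  let r : CharacterModule M →ₗ[R] CharacterModule (M ⧸ P) :=
    { toFun := fun φ => QuotientAddGroup.lift _ (t φ) (ht φ)
      map_add' := fun φ ψ => CharacterModule.dual_injective_of_surjective P.mkQ P.mkQ_surjective
        (map_add t φ ψ)
      map_smul' := fun a φ => CharacterModule.dual_injective_of_surjective P.mkQ P.mkQ_surjective
        (map_smul t a φ) }
  refine ⟨r, fun φ => CharacterModule.dual_injective_of_surjective P.mkQ P.mkQ_surjective ?_⟩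
  change t (CharacterModule.dual P.mkQ φ) = _
  have : CharacterModule.dual P.subtype (CharacterModule.dual P.mkQ φ) = 0 := by
    refine CharacterModule.ext _ fun x => ?_
    change φ (P.mkQ x) = 0
    rw [Submodule.mkQ_apply, (Submodule.Quotient.mk_eq_zero P).2 x.2, map_zero]
  simp only [t, LinearMap.sub_apply, LinearMap.comp_apply, this, map_zero, LinearMap.id_apply,
    sub_zero]

variable {C : Type u} [AddCommGroup C] [Module R C] {n : ℕ}

theorem IsCFpInjective.quotient (hn : 0 < n) (hC : IsSemidualizing R C)
    (h : IsCFpInjective R C n M) {P : Submodule R M} (hP : IsPureSubmodule P) :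
    IsCFpInjective R C n (M ⧸ P) := by
  rw [isCFpInjective_iff_character hn hC] at *
  obtain ⟨r, hr⟩ := hP.exists_retraction
  exact h.of_retract hn hC _ r hr

theorem IsCFpFlat.submodule (hn : 0 < n) (hC : IsSemidualizing R C)
    (h : IsCFpFlat R C n M) {P : Submodule R M} (hP : IsPureSubmodule P) :
    IsCFpFlat R C n P := by
  rw [isCFpFlat_iff_character hn hC] at *
  obtain ⟨s, hs⟩ := hP.exists_section
  exact h.of_retract hn hC s _ hs

/-- N consists of the values of all well-founded terms built from the operations `op`, addition,
scalars and zero; counting terms bounds N. -/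
theorem exists_submodule_closed_under {ι : Type u} {β : ι → Type u} (op : ∀ i, (β i → M) → M)
    {κ : Cardinal.{u}} (hκ : ℵ₀ ≤ κ) (hR : #R ≤ κ) (hι : #ι ≤ κ) (hβ : ∀ i, κ ^ #(β i) ≤ κ) :
    ∃ N : Submodule R M, #N ≤ κ ∧ ∀ i b, (∀ x, b x ∈ N) → op i b ∈ N := by
  let A : Type u := ι ⊕ (R ⊕ PUnit)
  let B : A → Type u := Sum.elim β (Sum.elim (fun _ => ULift Bool) fun _ => PEmpty)
  let ev : WType B → M := fun w => WType.elim M (fun p : Σ a : A, B a → M =>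
    match p with
    | ⟨.inl i, b⟩ => op i b
    | ⟨.inr (.inl r), b⟩ => r • b ⟨false⟩ + b ⟨true⟩
    | ⟨.inr (.inr _), _⟩ => 0) w
  have hfin (a : ℕ) : κ ^ (a : Cardinal.{u}) ≤ κ := by
    rw [Cardinal.power_natCast]
    exact Cardinal.power_nat_le hκ
  have hB (a : A) : κ ^ #(B a) ≤ κ := by
    rcases a with i | r | _
    · exact hβ i
    · have : #(ULift.{u} Bool) = (2 : ℕ) := by simp
      change κ ^ #(ULift.{u} Bool) ≤ κ
      rw [this]
      exact hfin 2
    · change κ ^ #PEmpty ≤ κ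
      rw [Cardinal.mk_eq_zero, Cardinal.power_zero]
      exact Cardinal.one_le_aleph0.trans hκ
  have hA : #A ≤ κ := by
    simp only [A, Cardinal.mk_sum, Cardinal.lift_id]
    refine Cardinal.add_le_of_le hκ hι (Cardinal.add_le_of_le hκ hR ?_)
    simpa using Cardinal.one_le_aleph0.trans hκ
  have hW : #(WType B) ≤ κ := by
    refine WType.cardinalMk_le_of_le ((Cardinal.sum_le_sum _ (fun _ => κ) hB).trans ?_)
    rw [Cardinal.sum_const']
    exact Cardinal.mul_le_of_le hκ hA le_rfl
  let N : Submodule R M :=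
    { carrier := Set.range ev
      zero_mem' := ⟨WType.mk (.inr (.inr ⟨⟩)) PEmpty.elim, rfl⟩
      add_mem' := by
        rintro _ _ ⟨v, rfl⟩ ⟨w, rfl⟩
        exact ⟨WType.mk (.inr (.inl 1)) fun b => if b.down then w else v, by simp [ev, WType.elim]⟩
      smul_mem' := by
        rintro r _ ⟨v, rfl⟩
        let z : WType B := WType.mk (.inr (.inr ⟨⟩)) PEmpty.elim
        exact ⟨WType.mk (.inr (.inl r)) fun b => if b.down then z else v,
          by simp [ev, z, WType.elim]⟩ }
  refine ⟨N, Cardinal.mk_range_le.trans hW, fun i b hb => ?_⟩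
  choose w hw using hb
  exact ⟨WType.mk (.inl i) w, congrArg (op i) (funext hw)⟩

/-- A Löwenheim–Skolem closure: the operations are the constants of S and, for each finite system
and each unknown, one coordinate of a chosen solution. -/
theorem exists_isPureSubmodule_of_card_le (S : Set M) {κ : Cardinal.{u}} (hκ : ℵ₀ ≤ κ)
    (hR : #R ≤ κ) (hS : #S ≤ κ) :
    ∃ P : Submodule R M, S ⊆ P ∧ IsPureSubmodule P ∧ #P ≤ κ := by
  classical
  let ι : Type u := S ⊕ (Σ k : ULift.{u} ℕ, Σ m : ULift.{u} ℕ,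
    (Fin k.down → Fin m.down → R) × ULift.{u} (Fin m.down))
  let β : ι → Type u := Sum.elim (fun _ => PEmpty) fun p => ULift.{u} (Fin p.1.down)
  let op : ∀ i, (β i → M) → M := fun i => match i with
    | .inl s => fun _ => s
    | .inr ⟨_, _, r, j⟩ => fun b =>
      if h : ∃ y : Fin _ → M, ∀ i, ∑ j, r i j • y j = b ⟨i⟩ then h.choose j.down else 0
  have hfin (a : ℕ) {c : Cardinal.{u}} (hc : c ≤ κ) : c ^ (a : Cardinal.{u}) ≤ κ := by
    refine (Cardinal.power_le_power_right hc).trans ?_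
    rw [Cardinal.power_natCast]
    exact Cardinal.power_nat_le hκ
  have hnat : #(ULift.{u} ℕ) ≤ κ := by simpa using hκ
  have hι : #ι ≤ κ := by
    simp only [ι, Cardinal.mk_sum, Cardinal.lift_id]
    refine Cardinal.add_le_of_le hκ hS ?_
    rw [Cardinal.mk_sigma]
    refine (Cardinal.sum_le_sum _ (fun _ => κ) fun k => ?_).trans ?_
    · rw [Cardinal.mk_sigma]
      refine (Cardinal.sum_le_sum _ (fun _ => κ) fun m => ?_).trans ?_
      · rw [Cardinal.mk_prod, Cardinal.lift_id, Cardinal.lift_id]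
        refine Cardinal.mul_le_of_le hκ ?_ ?_
        · have : #(Fin k.down → Fin m.down → R) = (#R ^ (m.down : Cardinal.{u})) ^ (k.down : Cardinal.{u}) := by
            simp
          rw [this]
          exact hfin _ (hfin _ hR)
        · simpa using (Cardinal.natCast_lt_aleph0.le).trans hκ
      · rw [Cardinal.sum_const']
        exact Cardinal.mul_le_of_le hκ hnat le_rfl
    · rw [Cardinal.sum_const']
      exact Cardinal.mul_le_of_le hκ hnat le_rfl
  have hβ : ∀ i, κ ^ #(β i) ≤ κ := by
    rintro (s | p)
    · change κ ^ #PEmpty ≤ κ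
      rw [Cardinal.mk_eq_zero, Cardinal.power_zero]
      exact Cardinal.one_le_aleph0.trans hκ
    · change κ ^ #(ULift.{u} (Fin p.1.down)) ≤ κ
      have : #(ULift.{u} (Fin p.1.down)) = (p.1.down : Cardinal.{u}) := by simp
      rw [this]
      exact hfin _ le_rfl
  obtain ⟨P, hPκ, hP⟩ := exists_submodule_closed_under (R := R) op hκ hR hι hβ
  refine ⟨P, fun s hs => hP (.inl ⟨s, hs⟩) PEmpty.elim fun x => x.elim, ?_, hPκ⟩
  intro k m r y hy
  have h : ∃ z : Fin m → M, ∀ i, ∑ j, r i j • z j = ∑ j, r i j • y j := ⟨y, fun _ => rfl⟩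
  refine ⟨h.choose, fun j => ?_, h.choose_spec⟩
  have := hP (.inr ⟨⟨k⟩, ⟨m⟩, r, ⟨j⟩⟩) (fun i => ∑ j, r i.down j • y j) fun i => hy i.down
  simp only [op] at this
  rw [dif_pos h] at this
  exact this

end Purity

/-! ### Bounding a module modulo a pure submodule of a kernel. -/

section SmallQuotients

open Cardinal

variable {R : Type u} [CommRing R]

/-- If F were larger, a submodule N of size at most 2^μ with strong closure properties would be
proper. A small pure submodule A of F ⧸ N then lifts to an isomorphic pure submodule of F inside ker
f, which must be zero although A is not. -/
theorem card_le_of_forall_isPureSubmodule_eq_bot {F M : Type u} [AddCommGroup F] [Module R F]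
    [AddCommGroup M] [Module R M] (f : F →ₗ[R] M)
    (h : ∀ P : Submodule R F, IsPureSubmodule P → P ≤ LinearMap.ker f → P = ⊥) :
    #F ≤ 2 ^ max (max #R #M) ℵ₀ := by
  classical
  set μ : Cardinal.{u} := max (max #R #M) ℵ₀ with hμ
  have hμ0 : ℵ₀ ≤ μ := le_max_right _ _
  have hR : #R ≤ μ := (le_max_left _ _).trans (le_max_left _ _)
  have hM : #M ≤ μ := (le_max_right _ _).trans (le_max_left _ _)
  have hμ2 : μ ≤ 2 ^ μ := (Cardinal.cantor μ).le
  have h20 : ℵ₀ ≤ (2 : Cardinal.{u}) ^ μ := hμ0.trans hμ2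
  let J : Type u := μ.out
  have hJ : #J = μ := Cardinal.mk_out μ
  have : Infinite J := Cardinal.infinite_iff.2 (hJ ▸ hμ0)
  let G : Type u := J →₀ R
  have hG : #G ≤ μ := by
    rcases subsingleton_or_nontrivial R with hs | hs
    · have : Subsingleton G := inferInstance
      exact (Cardinal.le_one_iff_subsingleton.2 this).trans (Cardinal.one_le_aleph0.trans hμ0)
    · have : #G = max #J #R := Cardinal.mk_finsupp_of_infinite J R
      rw [this, hJ]
      exact max_le le_rfl hR
  by_contra! hlt
  let ι : Type u := Set G × (G → M) × G
  -- The chosen map depends on the subset, the values on it and the prescribed composite with f, but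
  -- not on the evaluation point. Closure of N under these operations therefore puts all values of
  -- one and the same linear map in N.
  let op : ∀ i : ι, (i.1 → F) → F := fun i b =>
    if h : ∃ φ : G →ₗ[R] F, (∀ s : i.1, φ s = b s) ∧ ∀ x, f (φ x) = i.2.1 x then h.choose i.2.2
    else 0
  have hι : #ι ≤ 2 ^ μ := by
    simp only [ι, Cardinal.mk_prod, Cardinal.lift_id, Cardinal.mk_set, Cardinal.mk_arrow]
    refine Cardinal.mul_le_of_le h20 (Cardinal.power_le_power_left two_ne_zero hG)
      (Cardinal.mul_le_of_le h20 ?_ (hG.trans hμ2))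
    refine (Cardinal.power_le_power_right (hM.trans hμ2)).trans ?_
    rw [← Cardinal.power_mul]
    exact Cardinal.power_le_power_left two_ne_zero (Cardinal.mul_le_of_le hμ0 le_rfl hG)
  have hβ (i : ι) : ((2 : Cardinal.{u}) ^ μ) ^ #i.1 ≤ 2 ^ μ := by
    rw [← Cardinal.power_mul]
    exact Cardinal.power_le_power_left two_ne_zero
      (Cardinal.mul_le_of_le hμ0 le_rfl ((Cardinal.mk_set_le i.1).trans hG))
  obtain ⟨N, hNcard, hN⟩ := exists_submodule_closed_under (R := R) op h20 (hR.trans hμ2) hι hβ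
  obtain ⟨x, hx⟩ : ∃ x, x ∉ N := by
    by_contra! hall
    have : N = ⊤ := (Submodule.eq_top_iff').2 hall
    rw [this] at hNcard
    exact absurd (hlt.trans_le ((Cardinal.mk_congr Submodule.topEquiv.toEquiv).symm.le.trans hNcard))
      (lt_irrefl _)
  obtain ⟨A, hxA, hApure, hA⟩ := exists_isPureSubmodule_of_card_le (R := R) ({N.mkQ x} : Set (F ⧸ N))
    hμ0 hR (by simpa using Cardinal.one_le_aleph0.trans hμ0)
  obtain ⟨emb⟩ : Nonempty (A ↪ J) := (Cardinal.le_def _ _).1 (hA.trans hJ.symm.le)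
  let π : G →ₗ[R] A := Finsupp.linearCombination R (Function.invFun emb)
  have hπ : Function.Surjective π := fun a =>
    ⟨Finsupp.single (emb a) 1, (Finsupp.linearCombination_single R _ _).trans
      ((one_smul R _).trans (Function.leftInverse_invFun emb.injective a))⟩
  obtain ⟨g, hg⟩ := Module.projective_lifting_property N.mkQ (A.subtype ∘ₗ π) N.mkQ_surjective
  have hg' (y) : N.mkQ (g y) = π y := LinearMap.congr_fun hg y
  -- S is the kernel of π. Replacing g by a map φ into N that agrees with it on S and after f makes
  -- g - φ vanish on ker π, land in ker f and still lift π modulo N.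
  let S : Set G := {y | g y ∈ N}
  have hex : ∃ φ : G →ₗ[R] F, (∀ s : S, φ s = g s) ∧ ∀ x, f (φ x) = f (g x) :=
    ⟨g, fun _ => rfl, fun _ => rfl⟩
  let φ := hex.choose
  have hφS : ∀ s ∈ S, φ s = g s := fun s hs => hex.choose_spec.1 ⟨s, hs⟩
  have hφf : ∀ y, f (φ y) = f (g y) := hex.choose_spec.2
  have hφN (y) : φ y ∈ N := by
    have := hN (S, fun x => f (g x), y) (fun s => g s) fun s => s.2
    simp only [op] at this
    rwa [dif_pos hex] at this
  let P : Submodule R F := LinearMap.range (g - φ)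
  have hPpure : IsPureSubmodule P := by
    intro k m r y hy
    choose v hv using hy
    have hmem (i) : ∑ j, r i j • N.mkQ (y j) = π (v i) := by
      have : N.mkQ ((g - φ) (v i)) = N.mkQ (∑ j, r i j • y j) := by rw [hv]
      rw [LinearMap.sub_apply, map_sub, hg', N.mkQ_apply (φ _),
        (Submodule.Quotient.mk_eq_zero N).2 (hφN _), sub_zero, map_sum] at this
      simpa only [map_smul] using this.symm
    obtain ⟨z, hz, hzy⟩ := hApure k m r (fun j => N.mkQ (y j)) fun i => by
      rw [hmem]
      exact (π (v i)).2
    choose w hw using fun j => hπ ⟨z j, hz j⟩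
    refine ⟨fun j => (g - φ) (w j), fun j => ⟨_, rfl⟩, fun i => ?_⟩
    have hS : v i - ∑ j, r i j • w j ∈ S := by
      change g _ ∈ N
      rw [← Submodule.Quotient.mk_eq_zero, ← Submodule.mkQ_apply, hg', map_sub, map_sum]
      simp only [map_smul, hw, AddSubgroupClass.coe_sub, AddSubmonoidClass.coe_finsetSum,
        SetLike.val_smul, hzy, hmem, sub_self]
    have h0 : (g - φ) (v i - ∑ j, r i j • w j) = 0 := by
      rw [LinearMap.sub_apply, hφS _ hS, sub_self]
    rw [map_sub, sub_eq_zero, map_sum] at h0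
    rw [← hv i, h0]
    simp only [map_smul]
  have hPker : P ≤ LinearMap.ker f := by
    rintro _ ⟨y, rfl⟩
    rw [LinearMap.mem_ker, LinearMap.sub_apply, map_sub, hφf, sub_self]
  have hbot := h P hPpure hPker
  obtain ⟨v, hv⟩ := hπ ⟨N.mkQ x, hxA rfl⟩
  have h0 : (g - φ) v = 0 := (Submodule.mem_bot R).1 (hbot ▸ ⟨v, rfl⟩)
  have hgv : g v ∈ N := by
    rw [LinearMap.sub_apply, sub_eq_zero] at h0
    rw [h0]
    exact hφN v
  apply hx
  rw [← Submodule.Quotient.mk_eq_zero, ← Submodule.mkQ_apply]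
  have h1 : N.mkQ (g v) = N.mkQ x := by rw [hg', hv]
  rw [← h1, Submodule.mkQ_apply, Submodule.Quotient.mk_eq_zero]
  exact hgv

/-- Take a maximal pure submodule inside the kernel: preimages of pure submodules of the quotient
are pure, so the previous bound applies to the induced map. -/
theorem exists_isPureSubmodule_le_ker {F M : Type u} [AddCommGroup F] [Module R F]
    [AddCommGroup M] [Module R M] (f : F →ₗ[R] M) :
    ∃ P : Submodule R F, IsPureSubmodule P ∧ P ≤ LinearMap.ker f ∧
      #(F ⧸ P) ≤ 2 ^ max (max #R #M) ℵ₀ := by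
  obtain ⟨P, -, hP⟩ := zorn_le_nonempty₀ {P : Submodule R F | IsPureSubmodule P ∧ P ≤ LinearMap.ker f}
    (fun c hc hchain P hP => ⟨sSup c, ⟨isPureSubmodule_sSup_of_isChain hchain ⟨P, hP⟩
      fun Q hQ => (hc hQ).1, sSup_le fun Q hQ => (hc hQ).2⟩, fun Q hQ => le_sSup hQ⟩) ⊥
    ⟨isPureSubmodule_bot, bot_le⟩
  refine ⟨P, hP.prop.1, hP.prop.2, card_le_of_forall_isPureSubmodule_eq_bot
    (P.liftQ f hP.prop.2) fun Q hQ hQf => ?_⟩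
  have hle : P ≤ Q.comap P.mkQ := fun x hx => by
    rw [Submodule.mem_comap, Submodule.mkQ_apply, (Submodule.Quotient.mk_eq_zero P).2 hx]
    exact Q.zero_mem
  have := hP.le_of_ge ⟨hP.prop.1.comap_mkQ hQ, fun x hx => hQf hx⟩ hle
  rw [eq_bot_iff]
  intro q hq
  obtain ⟨x, rfl⟩ := P.mkQ_surjective q
  rw [Submodule.mem_bot, Submodule.mkQ_apply, Submodule.Quotient.mk_eq_zero]
  exact this hq

end SmallQuotients

/-! ### Precovers, preenvelopes and directed colimits. -/

section Approximations

open Cardinal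

variable {R : Type u} [CommRing R] {𝓕 : ∀ (F : Type u) [AddCommGroup F] [Module R F], Prop}

theorem exists_quotient_finsupp_equiv (κ : Cardinal.{u}) (N : Type u) [AddCommGroup N] [Module R N]
    (hN : #N ≤ κ) : ∃ U : Submodule R (κ.out →₀ R), Nonempty (((κ.out →₀ R) ⧸ U) ≃ₗ[R] N) := by
  obtain ⟨emb⟩ : Nonempty (N ↪ κ.out) := (Cardinal.le_def _ _).1 (hN.trans (Cardinal.mk_out κ).symm.le)
  let π : (κ.out →₀ R) →ₗ[R] N := Finsupp.linearCombination R (Function.invFun emb)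
  have hπ : Function.Surjective π := fun a =>
    ⟨Finsupp.single (emb a) 1, (Finsupp.linearCombination_single R _ _).trans
      ((one_smul R _).trans (Function.leftInverse_invFun emb.injective a))⟩
  exact ⟨LinearMap.ker π, ⟨π.quotKerEquivOfSurjective hπ⟩⟩

/-- Every map from the class to M factors through a pure quotient of bounded size, still in the
class. The direct sum over a set of representatives of such maps is a precover;
`exists_isPreenvelope` dualizes this with products and small pure submodules. -/
theorem exists_isPrecover
    (hiso : ∀ {A B : Type u} [AddCommGroup A] [Module R A] [AddCommGroup B] [Module R B],
      (A ≃ₗ[R] B) → 𝓕 A → 𝓕 B)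
    (hsum : ∀ {ι : Type u} (A : ι → Type u) [∀ i, AddCommGroup (A i)] [∀ i, Module R (A i)],
      (∀ i, 𝓕 (A i)) → 𝓕 (DirectSum ι A))
    (hquot : ∀ {A : Type u} [AddCommGroup A] [Module R A] (P : Submodule R A),
      IsPureSubmodule P → 𝓕 A → 𝓕 (A ⧸ P))
    (M : Type u) [AddCommGroup M] [Module R M] :
    ∃ (F : Type u) (_ : AddCommGroup F) (_ : Module R F) (f : F →ₗ[R] M),
      IsPrecover (R := R) 𝓕 f := by
  classical
  set κ : Cardinal.{u} := 2 ^ max (max #R #M) ℵ₀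
  obtain ⟨ι, A, g, hA, hg⟩ : ∃ (ι : Type u) (A : ι → ModuleCat.{u} R) (g : ∀ i, A i →ₗ[R] M),
      (∀ i, 𝓕 (A i)) ∧ ∀ (U : Submodule R (κ.out →₀ R)) (h : ((κ.out →₀ R) ⧸ U) →ₗ[R] M),
        𝓕 ((κ.out →₀ R) ⧸ U) → ∃ i, ∃ e : ((κ.out →₀ R) ⧸ U) →ₗ[R] A i, g i ∘ₗ e = h :=
    ⟨{p : Σ U : Submodule R (κ.out →₀ R), ((κ.out →₀ R) ⧸ U) →ₗ[R] M // 𝓕 ((κ.out →₀ R) ⧸ p.1)},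
      fun i => ModuleCat.of R ((κ.out →₀ R) ⧸ i.1.1), fun i => i.1.2, fun i => i.2,
      fun U h hU => ⟨⟨⟨U, h⟩, hU⟩, LinearMap.id, rfl⟩⟩
  refine ⟨DirectSum ι fun i => A i, inferInstance, inferInstance,
    DirectSum.toModule R ι M g, hsum _ hA, fun F' _ _ hF' h => ?_⟩
  obtain ⟨P, hP, hPh, hPκ⟩ := exists_isPureSubmodule_le_ker h
  obtain ⟨U, ⟨e⟩⟩ := exists_quotient_finsupp_equiv (R := R) κ (F' ⧸ P) hPκ
  obtain ⟨i, j, hij⟩ := hg U (P.liftQ h hPh ∘ₗ e.toLinearMap) (hiso e.symm (hquot P hP hF'))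
  refine ⟨DirectSum.lof R ι (fun i => A i) i ∘ₗ j ∘ₗ e.symm.toLinearMap ∘ₗ P.mkQ,
    LinearMap.ext fun x => ?_⟩
  simp only [LinearMap.comp_apply]
  rw [DirectSum.toModule_lof, ← LinearMap.comp_apply (g i), hij]
  simp

theorem exists_isPreenvelope
    (hiso : ∀ {A B : Type u} [AddCommGroup A] [Module R A] [AddCommGroup B] [Module R B],
      (A ≃ₗ[R] B) → 𝓕 A → 𝓕 B)
    (hpi : ∀ {ι : Type u} (A : ι → Type u) [∀ i, AddCommGroup (A i)] [∀ i, Module R (A i)],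
      (∀ i, 𝓕 (A i)) → 𝓕 (∀ i, A i))
    (hsub : ∀ {A : Type u} [AddCommGroup A] [Module R A] (P : Submodule R A),
      IsPureSubmodule P → 𝓕 A → 𝓕 P)
    (M : Type u) [AddCommGroup M] [Module R M] :
    ∃ (F : Type u) (_ : AddCommGroup F) (_ : Module R F) (f : M →ₗ[R] F),
      IsPreenvelope (R := R) 𝓕 f := by
  classical
  set κ : Cardinal.{u} := max (max #R #M) ℵ₀
  obtain ⟨ι, A, g, hA, hg⟩ : ∃ (ι : Type u) (A : ι → ModuleCat.{u} R) (g : ∀ i, M →ₗ[R] A i),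
      (∀ i, 𝓕 (A i)) ∧ ∀ (U : Submodule R (κ.out →₀ R)) (h : M →ₗ[R] ((κ.out →₀ R) ⧸ U)),
        𝓕 ((κ.out →₀ R) ⧸ U) → ∃ i, ∃ e : A i →ₗ[R] ((κ.out →₀ R) ⧸ U), e ∘ₗ g i = h :=
    ⟨{p : Σ U : Submodule R (κ.out →₀ R), M →ₗ[R] ((κ.out →₀ R) ⧸ U) // 𝓕 ((κ.out →₀ R) ⧸ p.1)},
      fun i => ModuleCat.of R ((κ.out →₀ R) ⧸ i.1.1), fun i => i.1.2, fun i => i.2,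
      fun U h hU => ⟨⟨⟨U, h⟩, hU⟩, LinearMap.id, rfl⟩⟩
  refine ⟨∀ i, A i, inferInstance, inferInstance, LinearMap.pi g, hpi _ hA, fun F' _ _ hF' h => ?_⟩
  obtain ⟨P, hhP, hP, hPκ⟩ := exists_isPureSubmodule_of_card_le (R := R) (Set.range h)
    (κ := κ) (le_max_right _ _) ((le_max_left _ _).trans (le_max_left _ _))
    (Cardinal.mk_range_le.trans ((le_max_right _ _).trans (le_max_left _ _)))
  obtain ⟨U, ⟨e⟩⟩ := exists_quotient_finsupp_equiv (R := R) κ P hPκ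
  obtain ⟨i, j, hij⟩ := hg U (e.symm.toLinearMap ∘ₗ h.codRestrict P fun x => hhP ⟨x, rfl⟩)
    (hiso e.symm (hsub P hP hF'))
  refine ⟨P.subtype ∘ₗ e.toLinearMap ∘ₗ j ∘ₗ LinearMap.proj i, LinearMap.ext fun x => ?_⟩
  have := LinearMap.congr_fun hij x
  simp only [LinearMap.comp_apply, LinearMap.proj_apply, LinearMap.pi_apply] at this ⊢
  rw [this]
  simp

/-- The colimit is the quotient of the direct sum by ker p, and this kernel is pure. -/
theorem mem_of_directed_colimit
    (hiso : ∀ {A B : Type u} [AddCommGroup A] [Module R A] [AddCommGroup B] [Module R B],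
      (A ≃ₗ[R] B) → 𝓕 A → 𝓕 B)
    (hsum : ∀ {ι : Type u} (A : ι → Type u) [∀ i, AddCommGroup (A i)] [∀ i, Module R (A i)],
      (∀ i, 𝓕 (A i)) → 𝓕 (DirectSum ι A))
    (hquot : ∀ {A : Type u} [AddCommGroup A] [Module R A] (P : Submodule R A),
      IsPureSubmodule P → 𝓕 A → 𝓕 (A ⧸ P))
    {J : Type u} [Preorder J] [IsDirectedOrder J] [Nonempty J] (X : J → Type u)
    [∀ j, AddCommGroup (X j)] [∀ j, Module R (X j)] (hX : ∀ j, 𝓕 (X j))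
    (τ : ∀ i j, i ≤ j → X i →ₗ[R] X j)
    (hτ : ∀ i j k (hij : i ≤ j) (hjk : j ≤ k) x, τ j k hjk (τ i j hij x) = τ i k (hij.trans hjk) x)
    {B : Type u} [AddCommGroup B] [Module R B] (b : ∀ j, X j →ₗ[R] B)
    (hb : ∀ i j (hij : i ≤ j) x, b j (τ i j hij x) = b i x)
    (hsurj : ∀ y, ∃ j x, b j x = y)
    (hker : ∀ j x, b j x = 0 → ∃ k, ∃ h : j ≤ k, τ j k h x = 0) : 𝓕 B := by
  classical
  let p : DirectSum J X →ₗ[R] B := DirectSum.toModule R J B b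
  have hp (j) (x : X j) : p (DirectSum.lof R J X j x) = b j x := DirectSum.toModule_lof _ _ _
  have hpsurj : Function.Surjective p := fun y => by
    obtain ⟨j, x, rfl⟩ := hsurj y
    exact ⟨_, hp j x⟩
  -- `e i` moves all components of index at most i to stage i. For finitely many elements and late i
  -- it preserves p and kills those in ker p, so y - e i y solves the system inside ker p.
  let e : J → DirectSum J X →ₗ[R] DirectSum J X := fun i => DirectSum.toModule R J _ fun j =>
    if h : j ≤ i then DirectSum.lof R J X i ∘ₗ τ j i h else 0
  have he (i j) (h : j ≤ i) (x : X j) :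
      e i (DirectSum.lof R J X j x) = DirectSum.lof R J X i (τ j i h x) := by
    simp only [e]
    rw [DirectSum.toModule_lof, dif_pos h, LinearMap.comp_apply]
  have hrep (y : DirectSum J X) : ∃ i, ∃ x : X i, ∀ k (h : i ≤ k),
      e k y = DirectSum.lof R J X k (τ i k h x) ∧ p y = b i x := by
    induction y using DirectSum.induction_on with
    | zero =>
      obtain ⟨i⟩ := ‹Nonempty J›
      exact ⟨i, 0, fun k h => by simp only [map_zero, and_self]⟩
    | of j x => exact ⟨j, x, fun k h => ⟨he k j h x, hp j x⟩⟩
    | add y z hy hz =>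
      obtain ⟨i, v, hv⟩ := hy
      obtain ⟨j, w, hw⟩ := hz
      obtain ⟨l, hil, hjl⟩ := exists_ge_ge i j
      refine ⟨l, τ i l hil v + τ j l hjl w, fun k h => ⟨?_, ?_⟩⟩
      · simp only [map_add, hτ]
        rw [(hv k (hil.trans h)).1, (hw k (hjl.trans h)).1]
      · simp only [map_add, hb]
        rw [(hv k (hil.trans h)).2, (hw k (hjl.trans h)).2]
  have hev1 (y : DirectSum J X) : ∀ᶠ i in Filter.atTop, p (e i y) = p y := by
    obtain ⟨i, x, hx⟩ := hrep y
    filter_upwards [Filter.eventually_ge_atTop i] with k hk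
    rw [(hx k hk).1, (hx k hk).2, hp, hb]
  have hev2 (y : DirectSum J X) (hy : p y = 0) : ∀ᶠ i in Filter.atTop, e i y = 0 := by
    obtain ⟨i, x, hx⟩ := hrep y
    obtain ⟨k, hik, hk⟩ := hker i x ((hx i le_rfl).2.symm.trans hy)
    filter_upwards [Filter.eventually_ge_atTop k] with l hl
    rw [(hx l (hik.trans hl)).1, ← hτ i k l hik hl, hk, map_zero, map_zero]
  have hpure : IsPureSubmodule (LinearMap.ker p) := by
    intro k m r y hy
    obtain ⟨i, hi1, hi2⟩ := ((Filter.eventually_all.2 fun j => hev1 (y j)).and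
      (Filter.eventually_all.2 fun s => hev2 _ (hy s))).exists
    refine ⟨fun j => y j - e i (y j), fun j => ?_, fun s => ?_⟩
    · rw [LinearMap.mem_ker, map_sub, hi1, sub_self]
    · have := hi2 s
      simp only [map_sum, map_smul] at this
      simp only [smul_sub, Finset.sum_sub_distrib, this, sub_zero]
  exact hiso (p.quotKerEquivOfSurjective hpsurj) (hquot _ hpure (hsum X hX))

end Approximations

/-! ### Weakly terminal objects with bijective endomorphisms. -/

section WeaklyTerminal

open CategoryTheory Limits Cardinal SmallObject

universe v

variable {D : Type v} [Category.{u} D] (U : D ⥤ Type u)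

theorem map_bijective_of_isIso {X Y : D} (e : X ⟶ Y) [IsIso e] : Function.Bijective (U.map e) :=
  (isIso_iff_bijective (U.map e)).1 inferInstance

theorem exists_bound_of_card_lt {κ : Cardinal.{u}} (hκ : κ.IsRegular) {K : Type u}
    (hK : #K < κ) (s : K → κ.ord.ToType) : ∃ j, ∀ k, s k ≤ j := by
  have : Fact κ.IsRegular := ⟨hκ⟩
  exact ⟨IsCardinalFiltered.max s (hasCardinalLT_iff_cardinal_mk_lt _ _ |>.2 hK),
    fun k => leOfHom (IsCardinalFiltered.toMax s _ k)⟩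

theorem hasIterationOfShape_of_linearOrder
    (hD : ∀ (J : Type u) [LinearOrder J] [Nonempty J], HasColimitsOfShape J D)
    (J : Type u) [LinearOrder J] [Nonempty J] : HasIterationOfShape J D where
  hasColimitsOfShape_of_isSuccLimit _ hj :=
    have := hj.nonempty_Iio.to_subtype
    hD _
  hasColimitsOfShape := hD J

/-- In a category with colimits of chains that are preserved by `U`, there is a weakly terminal
object such that all morphisms out of it are injective, if there is a weakly terminal object. -/
theorem exists_weaklyTerminal_forall_injective
    (hD : ∀ (J : Type u) [LinearOrder J] [Nonempty J], HasColimitsOfShape J D)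
    (hU : ∀ (J : Type u) [LinearOrder J] [Nonempty J], PreservesColimitsOfShape J U)
    (T : D) (hT : ∀ X : D, Nonempty (X ⟶ T)) :
    ∃ S : D, (∀ X : D, Nonempty (X ⟶ S)) ∧
      ∀ (X : D) (φ : S ⟶ X), Function.Injective (U.map φ) := by
  classical
  suffices h : ∃ S : D, (∀ X : D, Nonempty (X ⟶ S)) ∧
      ∀ (φ : S ⟶ T), Function.Injective (U.map φ) by
    obtain ⟨S, hS, hinj⟩ := h
    refine ⟨S, hS, fun X φ => ?_⟩
    obtain ⟨ψ⟩ := hT X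
    have := hinj (φ ≫ ψ)
    rw [U.map_comp, types_comp] at this
    exact Function.Injective.of_comp this
  -- Otherwise every weakly terminal object has a non-injective map to T. Iterating these maps
  -- transfinitely gives a chain with no injective step, to be refuted at a suitable limit stage.
  by_contra! hcon
  have ht (X : D) : ∃ φ : X ⟶ T, (∀ Y : D, Nonempty (Y ⟶ X)) → ¬ Function.Injective (U.map φ) := by
    by_cases hX : ∀ Y : D, Nonempty (Y ⟶ X)
    · obtain ⟨φ, hφ⟩ := hcon X hX
      exact ⟨φ, fun _ => hφ⟩
    · exact ⟨(hT X).some, fun h => absurd h hX⟩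
  choose t ht using ht
  let Φ : SuccStruct D := ⟨T, fun _ => T, t⟩
  let κ : Cardinal.{u} := Order.succ (max #(U.obj T × U.obj T) ℵ₀)
  have hκ : κ.IsRegular := isRegular_succ (le_max_right _ _)
  have hκT : #(U.obj T × U.obj T) < κ := Order.lt_succ_of_le (le_max_left _ _)
  have hκ0 : ℵ₀ < κ := Order.lt_succ_of_le (le_max_right _ _)
  let J : Type u := κ.ord.ToType
  have hbound {K : Type u} (hK : #K < κ) (s : K → J) : ∃ j, ∀ k, s k ≤ j :=
    exists_bound_of_card_lt hκ hK s
  have : NoMaxOrder J := Cardinal.noMaxOrder hκ.aleph0_le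
  have : Nonempty J := by simpa [J] using hκ.ne_zero
  let _ : OrderBot J := WellFoundedLT.toOrderBot J
  let _ : SuccOrder J := SuccOrder.ofLinearWellFoundedLT J
  have := hasIterationOfShape_of_linearOrder hD J
  let F : J ⥤ D := Φ.iterationFunctor J
  have hmax (j : J) : ¬ IsMax j := not_isMax j
  let e (j : J) : F.obj (Order.succ j) ≅ T := Φ.iterationFunctorObjSuccIso j (hmax j)
  have hFt (j : J) : F.map (homOfLE (Order.le_succ j)) = t (F.obj j) ≫ (e j).inv :=
    Φ.iterationFunctor_map_succ j (hmax j)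
  have hwt (j : J) (Y : D) : Nonempty (Y ⟶ F.obj j) :=
    ⟨(hT Y).some ≫ (Φ.iterationFunctorObjBotIso J).inv ≫ F.map (homOfLE bot_le)⟩
  have hnon (j : J) : ¬ Function.Injective (U.map (F.map (homOfLE (Order.le_succ j)))) := by
    rw [hFt, U.map_comp, types_comp]
    exact fun h => ht _ (hwt j) (Function.Injective.of_comp h)
  have hcomp {i j k : J} (hij : i ≤ j) (hjk : j ≤ k) (x : U.obj (F.obj i)) :
      U.map (F.map (homOfLE hjk)) (U.map (F.map (homOfLE hij)) x) =
        U.map (F.map (homOfLE (hij.trans hjk))) x := by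
    rw [← homOfLE_comp hij hjk, F.map_comp, U.map_comp]
    rfl
  -- The object at stage i + 1 is isomorphic to T and so has fewer than κ pairs of elements; by
  -- regularity, all identifications that ever occur among them have occurred by one stage.
  have hb (i : J) : ∃ j, ∃ hj : Order.succ i ≤ j, ∀ (k : J) (hk : Order.succ i ≤ k)
      (x y : U.obj (F.obj (Order.succ i))),
      U.map (F.map (homOfLE hk)) x = U.map (F.map (homOfLE hk)) y →
      U.map (F.map (homOfLE hj)) x = U.map (F.map (homOfLE hj)) y := by
    let X := U.obj (F.obj (Order.succ i))
    have hX : #(X × X) < κ := by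
      have : X ≃ U.obj T := Equiv.ofBijective _ (map_bijective_of_isIso U (e i).hom)
      rwa [Cardinal.mk_congr (this.prodCongr this)]
    let Q (p : X × X) (k : J) : Prop := ∃ hk : Order.succ i ≤ k,
      U.map (F.map (homOfLE hk)) p.1 = U.map (F.map (homOfLE hk)) p.2
    obtain ⟨j, hj⟩ := hbound hX fun p => if h : ∃ k, Q p k then h.choose else Order.succ i
    refine ⟨max j (Order.succ i), le_max_right _ _, fun k hk x y hxy => ?_⟩
    have hex : ∃ k, Q (x, y) k := ⟨k, hk, hxy⟩
    obtain ⟨hk', hxy'⟩ := hex.choose_spec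
    have hle : hex.choose ≤ max j (Order.succ i) := by
      have := hj (x, y)
      rw [dif_pos hex] at this
      exact this.trans (le_max_left _ _)
    rw [← hcomp hk' hle, ← hcomp hk' hle]
    exact congrArg _ hxy'
  choose b hb hb' using hb
  -- Alternating b with successors for ω steps gives a supremum γ below κ. A pair in the colimit at
  -- γ comes from some earlier stage, and if it is identified at γ + 1 it was already identified
  -- before γ, so the step at γ is injective.
  let a : ℕ → J := fun n => Nat.rec ⊥ (fun _ j => Order.succ (b j)) n
  have ha (n : ℕ) : a (n + 1) = Order.succ (b (a n)) := rfl
  have hlt (n : ℕ) : Order.succ (a n) < a (n + 1) := (hb (a n)).trans_lt (Order.lt_succ _)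
  have hlt' (n : ℕ) : a n < a (n + 1) := (Order.lt_succ _).trans (hlt n)
  obtain ⟨m, hm⟩ : ∃ m, ∀ n, a n < m := by
    obtain ⟨m, hm⟩ := hbound (K := ULift.{u} ℕ) (by simpa using hκ0) fun n => a n.down
    exact ⟨Order.succ m, fun n => (hm ⟨n⟩).trans_lt (Order.lt_succ _)⟩
  let γ := WellFounded.min (wellFounded_lt (α := J)) {m | ∀ n, a n < m} ⟨m, hm⟩
  have hγ (n : ℕ) : a n < γ := WellFounded.min_mem wellFounded_lt {m | ∀ n, a n < m} ⟨m, hm⟩ n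
  have hγ' (j : J) (hj : j < γ) : ∃ n, j ≤ a n := by
    by_contra! h
    exact WellFounded.not_lt_min wellFounded_lt {m | ∀ n, a n < m} h hj
  have hlim : Order.IsSuccLimit γ := by
    refine ⟨fun h => (h (hγ 0).le).not_gt (hγ 0), fun j hj => ?_⟩
    obtain ⟨n, hn⟩ := hγ' j hj.lt
    exact hj.2 (hn.trans_lt (hlt' n)) (hγ (n + 1))
  have hkey (i : J) (hi : i < γ) (x y : U.obj (F.obj i))
      (hxy : U.map (F.map (homOfLE (Order.le_succ γ))) (U.map (F.map (homOfLE hi.le)) x) =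
        U.map (F.map (homOfLE (Order.le_succ γ))) (U.map (F.map (homOfLE hi.le)) y)) :
      U.map (F.map (homOfLE hi.le)) x = U.map (F.map (homOfLE hi.le)) y := by
    obtain ⟨n, hn⟩ := hγ' i hi
    have hin : i ≤ Order.succ (a n) := hn.trans (Order.le_succ _)
    have hnb : b (a n) ≤ γ := ((Order.le_succ _).trans (ha n).ge).trans (hγ (n + 1)).le
    have hsγ : Order.succ (a n) ≤ γ := (hb _).trans hnb
    rw [hcomp, hcomp, ← hcomp hin (hsγ.trans (Order.le_succ γ)),
      ← hcomp hin (hsγ.trans (Order.le_succ γ))] at hxy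
    have := hb' _ _ _ _ _ hxy
    rw [← hcomp hin hsγ, ← hcomp hin hsγ, ← hcomp (hb (a n)) hnb, ← hcomp (hb (a n)) hnb, this]
  have := hlim.nonempty_Iio.to_subtype
  have := hU (Set.Iio γ)
  have hcol := isColimitOfPreserves U (F.isColimitOfIsWellOrderContinuous γ hlim)
  apply hnon γ
  intro x y hxy
  obtain ⟨⟨i, hi⟩, x', y', rfl, rfl⟩ :=
    Types.FilteredColimit.jointly_surjective_of_isColimit₂ hcol x y
  exact hkey i hi x' y' hxy

/-- In a category with colimits of chains that are preserved by `U`, there is a weakly terminal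
object all of whose endomorphisms are bijective, if there is a weakly terminal object. -/
theorem exists_weaklyTerminal_forall_bijective
    (hD : ∀ (J : Type u) [LinearOrder J] [Nonempty J], HasColimitsOfShape J D)
    (hU : ∀ (J : Type u) [LinearOrder J] [Nonempty J], PreservesColimitsOfShape J U)
    (T : D) (hT : ∀ X : D, Nonempty (X ⟶ T)) :
    ∃ S : D, (∀ X : D, Nonempty (X ⟶ S)) ∧ ∀ g : S ⟶ S, Function.Bijective (U.map g) := by
  obtain ⟨S, hS, hinj⟩ := exists_weaklyTerminal_forall_injective U hD hU T hT
  refine ⟨S, hS, fun g => ⟨hinj S g, ?_⟩⟩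
  by_contra hg
  -- Each step factors through the non-surjective g, so each stage j + 1 has an element x j outside
  -- the image of stage j. The colimit of the chain maps to S, injectively on successor stages, so
  -- the x j have κ distinct images in S, too many.
  let Φ : SuccStruct D := ⟨S, fun _ => S, fun X => (hS X).some ≫ g⟩
  let κ : Cardinal.{u} := Order.succ (max #(U.obj S) ℵ₀)
  have hκ : κ.IsRegular := isRegular_succ (le_max_right _ _)
  have hκS : #(U.obj S) < κ := Order.lt_succ_of_le (le_max_left _ _)
  let J : Type u := κ.ord.ToType
  have hJ : #J = κ := by simp [J]
  have : NoMaxOrder J := Cardinal.noMaxOrder hκ.aleph0_le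
  have : Nonempty J := by simpa [J] using hκ.ne_zero
  let _ : OrderBot J := WellFoundedLT.toOrderBot J
  let _ : SuccOrder J := SuccOrder.ofLinearWellFoundedLT J
  have := hasIterationOfShape_of_linearOrder hD J
  have := hD J
  let F : J ⥤ D := Φ.iterationFunctor J
  have hmax (j : J) : ¬ IsMax j := not_isMax j
  let e (j : J) : F.obj (Order.succ j) ≅ S := Φ.iterationFunctorObjSuccIso j (hmax j)
  have hFt (j : J) : F.map (homOfLE (Order.le_succ j)) =
      ((hS (F.obj j)).some ≫ g) ≫ (e j).inv :=
    Φ.iterationFunctor_map_succ j (hmax j)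
  have hnon (j : J) : ¬ Function.Surjective (U.map (F.map (homOfLE (Order.le_succ j)))) := by
    rw [hFt, U.map_comp, types_comp,
      Function.Surjective.of_comp_iff' (map_bijective_of_isIso U (e j).inv), U.map_comp, types_comp]
    exact fun h => hg (Function.Surjective.of_comp h)
  have hx (j : J) : ∃ x, ∀ y, U.map (F.map (homOfLE (Order.le_succ j))) y ≠ x := by
    by_contra! h
    exact hnon j h
  choose x hx using hx
  obtain ⟨h⟩ := hS (colimit F)
  let q (j : J) : F.obj j ⟶ S := colimit.ι F j ≫ h
  have hq {i j : J} (hij : i ≤ j) : F.map (homOfLE hij) ≫ q j = q i := by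
    simp only [q, colimit.w_assoc]
  have hqinj (j : J) : Function.Injective (U.map (q (Order.succ j))) := by
    have := hinj S ((e j).inv ≫ q (Order.succ j))
    rwa [U.map_comp, types_comp,
      Function.Injective.of_comp_iff' _ (map_bijective_of_isIso U (e j).inv)] at this
  have hne (i j : J) (hij : i < j) :
      U.map (q (Order.succ i)) (x i) ≠ U.map (q (Order.succ j)) (x j) := by
    intro heq
    have h1 : Order.succ i ≤ j := Order.succ_le_of_lt hij
    rw [← hq (h1.trans (Order.le_succ j)), U.map_comp, types_comp_apply] at heq
    have h2 := hqinj j heq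
    rw [← homOfLE_comp h1 (Order.le_succ j), F.map_comp, U.map_comp, types_comp_apply] at h2
    exact hx j _ h2
  have hι : Function.Injective fun j : J => U.map (q (Order.succ j)) (x j) := by
    intro i j hij
    rcases lt_trichotomy i j with h | h | h
    · exact absurd hij (hne i j h)
    · exact h
    · exact absurd hij.symm (hne j i h)
  exact absurd (Cardinal.mk_le_of_injective hι) (by rw [hJ]; exact not_le.2 hκS)

end WeaklyTerminal

/-! ### From precovers to covers. -/

section Covers

open CategoryTheory Limits

variable {R : Type u} [CommRing R] {𝓕 : ∀ (F : Type u) [AddCommGroup F] [Module R F], Prop}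

/-- The modules over `M` whose source belongs to a class of modules. -/
def overProperty (𝓕 : ∀ (F : Type u) [AddCommGroup F] [Module R F], Prop) (M : ModuleCat.{u} R) :
    ObjectProperty (Over M) := fun X => 𝓕 X.left

theorem overProperty_isClosedUnderColimitsOfShape
    (hiso : ∀ {A B : Type u} [AddCommGroup A] [Module R A] [AddCommGroup B] [Module R B],
      (A ≃ₗ[R] B) → 𝓕 A → 𝓕 B)
    (hsum : ∀ {ι : Type u} (A : ι → Type u) [∀ i, AddCommGroup (A i)] [∀ i, Module R (A i)],
      (∀ i, 𝓕 (A i)) → 𝓕 (DirectSum ι A))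
    (hquot : ∀ {A : Type u} [AddCommGroup A] [Module R A] (P : Submodule R A),
      IsPureSubmodule P → 𝓕 A → 𝓕 (A ⧸ P))
    (M : ModuleCat.{u} R) (J : Type u) [LinearOrder J] [Nonempty J] :
    (overProperty 𝓕 M).IsClosedUnderColimitsOfShape J where
  colimitsOfShape_le X hX := by
    obtain ⟨⟨⟨G, i, hc⟩, hG⟩⟩ := hX
    let V : Over M ⥤ Type u := Over.forget M ⋙ forget (ModuleCat.{u} R)
    have hV := isColimitOfPreserves V hc
    refine mem_of_directed_colimit (J := J) hiso hsum hquot (fun j => (G.obj j).left) hG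
      (fun i j h => (G.map (homOfLE h)).left.hom) (fun i j k hij hjk x => ?_)
      (fun j => (i.app j).left.hom) (fun a b hab x => ?_) (fun y => ?_) (fun j x hx => ?_)
    · rw [← homOfLE_comp hij hjk, G.map_comp]
      rfl
    · exact congrArg (fun f => f.left.hom x) (i.naturality (homOfLE hab))
    · exact Types.jointly_surjective_of_isColimit hV y
    · have h0 : (V.mapCocone ⟨X, i⟩).ι.app j x = (V.mapCocone ⟨X, i⟩).ι.app j (0 : (G.obj j).left) :=
        hx.trans (map_zero (i.app j).left.hom).symm
      obtain ⟨k, f, hf⟩ := (Types.FilteredColimit.isColimit_eq_iff' hV x _).1 h0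
      refine ⟨k, leOfHom f, ?_⟩
      have : (G.map f).left.hom x = (G.map f).left.hom 0 := hf
      rw [map_zero] at this
      exact this

/-- In the category of members of the class over M, a precover is a weakly terminal object; it is a
cover once all its endomorphisms are bijective. -/
theorem exists_isCover
    (hiso : ∀ {A B : Type u} [AddCommGroup A] [Module R A] [AddCommGroup B] [Module R B],
      (A ≃ₗ[R] B) → 𝓕 A → 𝓕 B)
    (hsum : ∀ {ι : Type u} (A : ι → Type u) [∀ i, AddCommGroup (A i)] [∀ i, Module R (A i)],
      (∀ i, 𝓕 (A i)) → 𝓕 (DirectSum ι A))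
    (hquot : ∀ {A : Type u} [AddCommGroup A] [Module R A] (P : Submodule R A),
      IsPureSubmodule P → 𝓕 A → 𝓕 (A ⧸ P))
    (M : Type u) [AddCommGroup M] [Module R M] :
    ∃ (F : Type u) (_ : AddCommGroup F) (_ : Module R F) (f : F →ₗ[R] M),
      IsCover (R := R) 𝓕 f := by
  obtain ⟨F, _, _, f, hF, hf⟩ := exists_isPrecover hiso hsum hquot M
  let P := overProperty 𝓕 (ModuleCat.of R M)
  let U : P.FullSubcategory ⥤ Type u := P.ι ⋙ Over.forget _ ⋙ forget (ModuleCat.{u} R)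
  have hcl (J : Type u) [LinearOrder J] [Nonempty J] : P.IsClosedUnderColimitsOfShape J :=
    overProperty_isClosedUnderColimitsOfShape hiso hsum hquot _ J
  let T : P.FullSubcategory := ⟨Over.mk (ModuleCat.ofHom f), hF⟩
  obtain ⟨S, hS, hbij⟩ := exists_weaklyTerminal_forall_bijective U
    (fun J _ _ => have := hcl J; inferInstance) (fun J _ _ => have := hcl J; inferInstance) T
    (fun X => by
      obtain ⟨g, hg⟩ := hf X.obj.left X.property X.obj.hom.hom
      exact ⟨ObjectProperty.homMk (Over.homMk (ModuleCat.ofHom g) (ModuleCat.hom_ext hg))⟩)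
  refine ⟨S.obj.left, inferInstance, inferInstance, S.obj.hom.hom, ⟨S.property, fun F' _ _ hF' h => ?_⟩,
    fun g hg => ?_⟩
  · obtain ⟨φ⟩ := hS ⟨Over.mk (ModuleCat.ofHom h), hF'⟩
    exact ⟨φ.hom.left.hom, congrArg ModuleCat.Hom.hom (Over.w φ.hom)⟩
  · exact hbij (ObjectProperty.homMk (Over.homMk (ModuleCat.ofHom g) (ModuleCat.hom_ext hg)))

end Covers

/-! ### The equivalences. -/

section Main

open TensorProduct

variable {R : Type u} [CommRing R] {n : ℕ} {C : Type u} [AddCommGroup C] [Module R C]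

theorem exists_isCFpFlat_preenvelope (hn : 0 < n) (hC : IsSemidualizing R C) (M : Type u)
    [AddCommGroup M] [Module R M] :
    ∃ (F : Type u) (_ : AddCommGroup F) (_ : Module R F) (f : M →ₗ[R] F),
      IsPreenvelope (R := R) (fun N _ _ => IsCFpFlat R C n N) f :=
  exists_isPreenvelope (𝓕 := fun N _ _ => IsCFpFlat R C n N) (fun e h => h.of_equiv e)
    (fun _ _ _ h => IsCFpFlat.pi hn hC h) (fun _ hP h => h.submodule hn hC hP) M

theorem exists_isCFpInjective_cover (hn : 0 < n) (hC : IsSemidualizing R C) (M : Type u)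
    [AddCommGroup M] [Module R M] :
    ∃ (F : Type u) (_ : AddCommGroup F) (_ : Module R F) (f : F →ₗ[R] M),
      IsCover (R := R) (fun N _ _ => IsCFpInjective R C n N) f :=
  exists_isCover (𝓕 := fun N _ _ => IsCFpInjective R C n N) (fun e h => h.of_equiv e)
    (fun _ _ _ h => IsCFpInjective.directSum hn hC h) (fun _ hP h => h.quotient hn hC hP) M

theorem IsFpFlat.hom_injective {Y E : Type u} [AddCommGroup Y] [Module R Y] [AddCommGroup E]
    [Module R E] (hY : IsFpFlat R n Y) (hE : Module.Injective R E) :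
    IsFpInjective R n (Y →ₗ[R] E) := by
  intro K L _ _ _ _ hK hL f hf g
  obtain ⟨h, hh⟩ := hE.out (f.rTensor Y) (hY K L hK hL f hf) (TensorProduct.lift g)
  exact ⟨TensorProduct.curry h, LinearMap.ext₂ fun x y => by simpa using hh (x ⊗ₜ y)⟩

theorem IsFpInjective.hom_projective {P X : Type u} [AddCommGroup P] [Module R P] [AddCommGroup X]
    [Module R X] (hP : Module.Projective R P) (hX : IsFpInjective R n X) :
    IsFpInjective R n (P →ₗ[R] X) := by
  intro K L _ _ _ _ hK hL f hf g
  obtain ⟨h, hh⟩ := Module.projective_lifting_property (LinearMap.lcomp R X f) g.flip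
    (hX K L hK hL f hf)
  exact ⟨h.flip, LinearMap.ext₂ fun x y => LinearMap.congr_fun (LinearMap.congr_fun hh y) x⟩

theorem isCFpInjective_hom_of_projective (hn : 0 < n) (hC : IsSemidualizing R C)
    (h : IsCFpInjective R C n R) {P P' : Type u} [AddCommGroup P] [Module R P] [AddCommGroup P']
    [Module R P'] (hP : Module.Projective R P) (hP' : Module.Projective R P') :
    IsCFpInjective R C n (P →ₗ[R] P') := by
  obtain ⟨X, _, _, hX, ⟨e⟩⟩ : IsCFpInjective R C n P' := IsCFpInjective.of_flat hn hC h
  exact ⟨P →ₗ[R] X, _, _, hX.hom_projective hP,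
    ⟨(LinearEquiv.congrRight e).trans LinearMap.lflip⟩⟩

theorem isCFpInjective_hom_of_injective (hn : 0 < n) (hC : IsSemidualizing R C)
    (h : IsCFpInjective R C n R) {E E' : Type u} [AddCommGroup E] [Module R E] [AddCommGroup E']
    [Module R E'] (hE : Module.Injective R E) (hE' : Module.Injective R E') :
    IsCFpInjective R C n (E →ₗ[R] E') := by
  obtain ⟨Y, _, _, hY, ⟨e⟩⟩ := IsCFpFlat.of_injective hn hC h hE
  exact ⟨Y →ₗ[R] E', _, _, hY.hom_injective hE',
    ⟨(LinearEquiv.congrLeft E' R e).trans (TensorProduct.lift.equiv (.id R) C Y E').symm⟩⟩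

theorem injective_character_ring : Module.Injective R (CharacterModule R) :=
  Module.Flat.iff_characterModule_injective.1 inferInstance

end Main

theorem theorem5p4 (R : Type u) [CommRing R] (C : Type u) [AddCommGroup C] [Module R C]
    (hC : IsSemidualizing R C) (n : ℕ) (hn : 0 < n) :
    List.TFAE [
      IsCFpInjective R C n R,
      ∀ (M : Type u) [AddCommGroup M] [Module R M],
        ∃ (F : Type u) (_ : AddCommGroup F) (_ : Module R F) (f : M →ₗ[R] F),
          IsPreenvelope (R := R) (fun N _ _ => IsCFpFlat R C n N) f ∧ Function.Injective f,
      ∀ (E E' : Type u) [AddCommGroup E] [Module R E] [AddCommGroup E'] [Module R E'],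
        Module.Injective R E → Module.Injective R E' →
          IsCFpInjective R C n (E →ₗ[R] E'),
      ∀ (F F' : Type u) [AddCommGroup F] [Module R F] [AddCommGroup F'] [Module R F'],
        Module.Flat R F → Module.Flat R F' →
          IsCFpInjective R C n (TensorProduct R F F'),
      ∀ (M : Type u) [AddCommGroup M] [Module R M],
        ∃ (F : Type u) (_ : AddCommGroup F) (_ : Module R F) (f : F →ₗ[R] M),
          IsCover (R := R) (fun N _ _ => IsCFpInjective R C n N) f ∧ Function.Surjective f,
      ∀ (P P' : Type u) [AddCommGroup P] [Module R P] [AddCommGroup P'] [Module R P'],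
        Module.Projective R P → Module.Projective R P' →
          IsCFpInjective R C n (P →ₗ[R] P')] := by
  tfae_have 1 → 2 := by
    intro h M _ _
    obtain ⟨F, _, _, f, hf⟩ := exists_isCFpFlat_preenvelope hn hC M
    obtain ⟨E, _, _, i, hi, hE⟩ := exists_injective_isCFpFlat hn hC h M
    obtain ⟨g, rfl⟩ := hf.2 E hE i
    exact ⟨F, _, _, f, hf, Function.Injective.of_comp hi⟩
  -- The character module of R is injective, hence a retract of its monic preenvelope.
  tfae_have 2 → 1 := by
    intro h
    obtain ⟨F, _, _, f, hf, hinj⟩ := h (CharacterModule R)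
    obtain ⟨r, hr⟩ := exists_leftInverse_of_injective injective_character_ring f hinj
    exact (isCFpInjective_iff_character hn hC).2 (hf.1.of_retract hn hC f r hr)
  tfae_have 1 → 3 := fun h E E' _ _ _ _ hE hE' => isCFpInjective_hom_of_injective hn hC h hE hE'
  -- By duality applied twice it suffices to treat R⋆⋆, which is Hom(R⋆, R⋆).
  tfae_have 3 → 1 := by
    intro h
    rw [isCFpInjective_iff_character hn hC, isCFpFlat_iff_character hn hC]
    exact (h (CharacterModule R) (CharacterModule R) injective_character_ring
      injective_character_ring).of_equiv
        (CharacterModule.homEquiv.trans (CharacterModule.congr (TensorProduct.rid R _)))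
  tfae_have 1 → 4 := fun h F F' _ _ _ _ _ _ => IsCFpInjective.of_flat hn hC h
  tfae_have 4 → 1 := fun h => (h R R inferInstance inferInstance).of_equiv (TensorProduct.rid R R)
  tfae_have 1 → 5 := by
    intro h M _ _
    obtain ⟨F, _, _, f, hf⟩ := exists_isCFpInjective_cover hn hC M
    refine ⟨F, _, _, f, hf, ?_⟩
    have hfree : IsCFpInjective R C n (M →₀ R) := IsCFpInjective.of_flat hn hC h
    obtain ⟨g, hg⟩ := hf.1.2 (M →₀ R) hfree (Finsupp.linearCombination R id)
    have hsurj := Finsupp.linearCombination_id_surjective R M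
    rw [← hg] at hsurj
    exact Function.Surjective.of_comp hsurj
  -- An epic cover of R splits.
  tfae_have 5 → 1 := by
    intro h
    obtain ⟨F, _, _, f, hf, hsurj⟩ := h R
    obtain ⟨x, hx⟩ := hsurj 1
    exact IsCFpInjective.of_retract hn hC (LinearMap.toSpanSingleton R F x) f
      (fun r => by simp [hx]) hf.1.1
  tfae_have 1 → 6 := fun h P P' _ _ _ _ hP hP' => isCFpInjective_hom_of_projective hn hC h hP hP'
  tfae_have 6 → 1 := fun h =>
    (h R R inferInstance inferInstance).of_equiv (LinearMap.ringLmapEquivSelf R R R)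
  tfae_finish
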